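/- Let $D$ be an affine star-shaped Dynkin diagram ($\widetilde D_4,\widetilde E_6,\widetilde E_7,\widetilde E_8$) with $m$ legs, $d_k$ the number of vertices of the $k$-th leg including the node; so $(d_1,\dots,d_m)$ is, up to ordering, $(2,2,2,2)$, $(3,3,3)$, $(2,4,4)$ or $(2,3,6)$. The legs are ordered so that $\ell:=d_m$ is the largest of the $d_k$. Let $n\ge 2$, and let $u=(u_{kj})_{1\le k\le m,\,1\le j\le d_k}$ and $t$ be nonzero complex numbers; put $q(u)=\prod_{k,j}u_{kj}^{-\ell/d_k}$. Let $H_n(u,t)$ be the $\mathbb C$-algebra generated by invertible elements $U_1,\dots,U_m,T_1,\dots,T_{n-1}$ with defining relations $$(U_1\cdots U_m)(T_1\cdots T_{n-2}T_{n-1}^2T_{n-2}\cdots T_1)=1,\quad T_iT_{i+1}T_i=T_{i+1}T_iT_{i+1},\quad [T_i,T_j]=0\ (|i-j|>1),$$ $$[U_j,T_i]=0\ (i\ge 2),\quad [U_j,T_1U_jT_1]=0,\quad [U_k,T_1^{-1}U_jT_1]=0\ (k<j),$$ $$\prod_{j=1}^{d_k}(U_k-u_{kj})=0,\quad T_i-T_i^{-1}=t-t^{-1}.$$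 Let $\mathbf H_{n,\ell}=\mathbf H_{n,\ell}(u_m,t)$ be the Ariki–Koike algebra: generators $U,T_1,\dots,T_{n-1}$, relations the braid and commutation relations of the $T_i$, $[U,T_i]=0$ for $i\ge2$, $UT_1UT_1=T_1UT_1U$, $\prod_{j=1}^{\ell}(U-u_{mj})=0$, $T_i-T_i^{-1}=t-t^{-1}$. Let $\eta_m:\mathbf H_{n,\ell}\to H_n(u,t)$ be the homomorphism $T_i\mapsto T_i$, $U\mapsto U_m$; let $\chi:\mathbf H_{n,\ell}\to\mathbb C$ be the character $T_i\mapsto t$, $U\mapsto u_{m\ell}$; and let $\mathbf H_{n-1,\ell}\subset\mathbf H_{n,\ell}$ be the subalgebra generated by $U,T_1,\dots,T_{n-2}$. Let $\mathbb R_{n,u,t}$ be the set of isomorphism classes of irreducible representations $V$ of $H_n(u,t)$ whose restriction along $\eta_m$ is isomorphic to the regular representation of $\mathbf H_{n,\ell}$. For such $V$ let $V'=V^{\mathbf H_{n-1,\ell}}$ be the subspace of vectors on which $\mathbf H_{n-1,\ell}$ acts through $\chi$. The elements $$\widetilde U_k=T_{n-1}\cdots T_1U_kT_1^{-1}\cdots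 T_{n-1}^{-1}\ (k<m),\qquad \widetilde U_m=T_{n-1}\cdots T_1U_mT_1\cdots T_{n-1}$$ commute with the image of $\mathbf H_{n-1,\ell}$ and hence preserve $V'$. Let $T$ be the $n\times n$ matrix with $T_{ij}=1-\delta_{ij}$, write $\sim$ for conjugacy of matrices, and let $\mathbb M_{n,u,t}$ be the set of simultaneous conjugacy classes of $m$-tuples $(X_1,\dots,X_m)\in GL_{n\ell}(\mathbb C)^m$ with $$X_1X_2\cdots X_m=1,\qquad X_k\sim\mathrm{diag}(u_{k1},\dots,u_{kd_k})\otimes\mathrm{Id}_{n\ell/d_k}\ (k<m),$$ $$X_m\sim u_{m\ell}t^{2T}\oplus\mathrm{diag}(u_{m1},\dots,u_{m,\ell-1})\otimes\mathrm{Id}_n.$$ Then for generic $(u,t)$ with $q(u)=1$ (i.e. for all $(u,t)$ in a nonempty Zariski open subset, depending only on $D$ and $n$, of the irreducible variety $\{q(u)=1\}$), every $V$ as above has $\dim V'=n\ell$, and $$\Phi(V)=(\widetilde U_1|_{V'},\dots,\widetilde U_m|_{V'})$$ is a well-defined map $\Phi:\mathbb R_{n,u,t}\to\mathbb M_{n,u,t}$.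 -/

import Mathlib

open Polynomial
open scoped Kronecker

noncomputable section

/-! ## Words in the generators `T` -/

/-- `T_1 T_2 ⋯ T_N`. (The family is indexed from `0`: `T_i` is `T ⟨i - 1, _⟩`.) -/
def ascProd {A : Type*} [Monoid A] {N : ℕ} (T : Fin N → A) : A := (List.ofFn T).prod

/-- `T_N ⋯ T_2 T_1`. -/
def descProd {A : Type*} [Monoid A] {N : ℕ} (T : Fin N → A) : A := (List.ofFn T).reverse.prod

theorem ascProd_succ' {A : Type*} [Monoid A] {N : ℕ} (T : Fin (N + 1) → A) :
    ascProd T = ascProd (fun i => T i.castSucc) * T (Fin.last N) := by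
  rw [ascProd, List.ofFn_succ', List.concat_eq_append, List.prod_append, List.prod_singleton]; rfl

theorem descProd_succ' {A : Type*} [Monoid A] {N : ℕ} (T : Fin (N + 1) → A) :
    descProd T = T (Fin.last N) * descProd (fun i => T i.castSucc) := by
  rw [descProd, List.ofFn_succ', List.concat_eq_append, List.reverse_append,
    List.reverse_singleton, List.prod_append, List.prod_singleton]; rfl

theorem ascProd_succ {A : Type*} [Monoid A] {N : ℕ} (T : Fin (N + 1) → A) :
    ascProd T = T 0 * ascProd (fun i => T i.succ) := by
  simp [ascProd, List.ofFn_succ]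

theorem descProd_succ {A : Type*} [Monoid A] {N : ℕ} (T : Fin (N + 1) → A) :
    descProd T = descProd (fun i => T i.succ) * T 0 := by
  simp [descProd, List.ofFn_succ]

theorem commute_ascProd {A : Type*} [Monoid A] {N : ℕ} (T : Fin N → A) (x : A)
    (h : ∀ i, Commute x (T i)) : Commute x (ascProd T) :=
  Commute.list_prod_right _ _ fun y hy => by
    obtain ⟨i, rfl⟩ := (List.mem_ofFn' T y).1 hy
    exact h i

theorem commute_descProd {A : Type*} [Monoid A] {N : ℕ} (T : Fin N → A) (x : A)
    (h : ∀ i, Commute x (T i)) : Commute x (descProd T) :=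
  Commute.list_prod_right _ _ fun y hy => by
    obtain ⟨i, rfl⟩ := (List.mem_ofFn' T y).1 (List.mem_reverse.1 hy)
    exact h i

theorem descProd_mul_ascProd {A : Type*} [Monoid A] {N : ℕ} (T S : Fin N → A)
    (h : ∀ i, T i * S i = 1) : descProd T * ascProd S = 1 := by
  induction N with
  | zero => simp [descProd, ascProd]
  | succ N ih =>
    rw [descProd_succ, ascProd_succ, mul_assoc, ← mul_assoc (T 0), h, one_mul]
    exact ih _ _ fun i => h _

theorem ascProd_mul_descProd {A : Type*} [Monoid A] {N : ℕ} (T S : Fin N → A)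
    (h : ∀ i, S i * T i = 1) : ascProd S * descProd T = 1 := by
  induction N with
  | zero => simp [descProd, ascProd]
  | succ N ih =>
    rw [descProd_succ', ascProd_succ', mul_assoc, ← mul_assoc (S _), h, one_mul]
    exact ih _ _ fun i => h _

theorem mul_descProd {A : Type*} [Monoid A] {N : ℕ} (T : Fin N → A)
    (hb : ∀ i j : Fin N, i.val + 1 = j.val → T i * T j * T i = T j * T i * T j)
    (hc : ∀ i j : Fin N, i.val + 1 < j.val ∨ j.val + 1 < i.val → T i * T j = T j * T i)
    (i j : Fin N) (h : i.val + 1 = j.val) : T i * descProd T = descProd T * T j := by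
  induction N with
  | zero => exact i.elim0
  | succ N ih =>
    rw [descProd_succ']
    have hi : i.val < N := by omega
    obtain ⟨i, rfl⟩ : ∃ i' : Fin N, i = i'.castSucc := ⟨⟨i, hi⟩, rfl⟩
    rcases Nat.lt_or_ge j.val N with hj | hj
    · obtain ⟨j, rfl⟩ : ∃ j' : Fin N, j = j'.castSucc := ⟨⟨j, hj⟩, rfl⟩
      have := ih (fun i => T i.castSucc) (fun a b hab => hb _ _ (by simpa using hab))
        (fun a b hab => hc _ _ (by simpa using hab)) i j (by simpa using h)
      rw [← mul_assoc, hc _ (Fin.last N) (by left; simp at h ⊢; omega), mul_assoc, this,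
        mul_assoc]
    · obtain rfl : j = Fin.last N := Fin.ext (by simp; omega)
      obtain ⟨M, rfl⟩ : ∃ M, N = M + 1 := ⟨N - 1, by omega⟩
      obtain rfl : i = Fin.last M := Fin.ext (by simp at h ⊢; omega)
      rw [descProd_succ']
      have hcm : Commute (T (Fin.last (M + 1)))
          (descProd fun i : Fin M => T i.castSucc.castSucc) :=
        commute_descProd _ _ fun a => hc _ _ (by right; simp)
      rw [← mul_assoc, ← mul_assoc, hb _ _ h, mul_assoc, hcm.eq]
      simp only [mul_assoc]

theorem ascProd_mul {A : Type*} [Monoid A] {N : ℕ} (T : Fin N → A)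
    (hb : ∀ i j : Fin N, i.val + 1 = j.val → T i * T j * T i = T j * T i * T j)
    (hc : ∀ i j : Fin N, i.val + 1 < j.val ∨ j.val + 1 < i.val → T i * T j = T j * T i)
    (i j : Fin N) (h : i.val + 1 = j.val) : ascProd T * T i = T j * ascProd T := by
  induction N with
  | zero => exact i.elim0
  | succ N ih =>
    rw [ascProd_succ']
    have hi : i.val < N := by omega
    obtain ⟨i, rfl⟩ : ∃ i' : Fin N, i = i'.castSucc := ⟨⟨i, hi⟩, rfl⟩
    rcases Nat.lt_or_ge j.val N with hj | hj
    · obtain ⟨j, rfl⟩ : ∃ j' : Fin N, j = j'.castSucc := ⟨⟨j, hj⟩, rfl⟩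
      have := ih (fun i => T i.castSucc) (fun a b hab => hb _ _ (by simpa using hab))
        (fun a b hab => hc _ _ (by simpa using hab)) i j (by simpa using h)
      rw [mul_assoc, hc (Fin.last N) _ (by right; simp at h ⊢; omega), ← mul_assoc, this,
        mul_assoc]
    · obtain rfl : j = Fin.last N := Fin.ext (by simp; omega)
      obtain ⟨M, rfl⟩ : ∃ M, N = M + 1 := ⟨N - 1, by omega⟩
      obtain rfl : i = Fin.last M := Fin.ext (by simp at h ⊢; omega)
      rw [ascProd_succ']
      have hcm : Commute (T (Fin.last (M + 1)))
          (ascProd fun i : Fin M => T i.castSucc.castSucc) :=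
        commute_ascProd _ _ fun a => hc _ _ (by right; simp)
      have hb' := hb _ _ h
      simp only [mul_assoc] at hb' ⊢
      rw [hb', ← mul_assoc, ← hcm.eq, mul_assoc]

/-! ## Affine star-shaped diagrams -/

/-- An affine star-shaped Dynkin diagram (type `D̃₄`, `Ẽ₆`, `Ẽ₇`, `Ẽ₈`) with `m = r + 1` legs,
where `d k` is the number of vertices of the `k`-th leg including the node. The legs are ordered
arbitrarily, except that the last leg has maximal length. -/
structure AffineStar where
  r : ℕ
  d : Fin (r + 1) → ℕ
  shape : Finset.univ.val.map d = ({2, 2, 2, 2} : Multiset ℕ) ∨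
    Finset.univ.val.map d = ({3, 3, 3} : Multiset ℕ) ∨
    Finset.univ.val.map d = ({2, 4, 4} : Multiset ℕ) ∨
    Finset.univ.val.map d = ({2, 3, 6} : Multiset ℕ)
  le_last : ∀ k, d k ≤ d (Fin.last r)

namespace AffineStar

/-- The number of legs. -/
abbrev m (D : AffineStar) : ℕ := D.r + 1

/-- The index of the last leg. -/
abbrev lastLeg (D : AffineStar) : Fin D.m := Fin.last D.r

/-- `ℓ = d_m`. -/
abbrev ell (D : AffineStar) : ℕ := D.d D.lastLeg

theorem d_pos (D : AffineStar) (k : Fin D.m) : 0 < D.d k := by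
  have h : D.d k ∈ Finset.univ.val.map D.d :=
    Multiset.mem_map.2 ⟨k, Finset.mem_univ k, rfl⟩
  rcases D.shape with e | e | e | e <;> rw [e] at h <;> simp at h <;> omega

instance (D : AffineStar) (k : Fin D.m) : NeZero (D.d k) := ⟨(D.d_pos k).ne'⟩

/-- The parameters `u = (u_{kj})`, nonzero complex numbers. -/
abbrev Params (D : AffineStar) : Type := (k : Fin D.m) → Fin (D.d k) → ℂˣ

/-- `q(u) = ∏_{k,j} u_{kj}^{-ℓ/d_k}`. -/
def q (D : AffineStar) (u : D.Params) : ℂˣ :=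
  ∏ k, ∏ j, (u k j) ^ (-((D.ell / D.d k : ℕ) : ℤ))

/-- The value of a polynomial in the variables `u_{kj}` and `t` at a point `(u, t)`. -/
def evalAt (D : AffineStar) (P : MvPolynomial ((Σ k, Fin (D.d k)) ⊕ Unit) ℂ)
    (u : D.Params) (t : ℂˣ) : ℂ :=
  MvPolynomial.eval (Sum.elim (fun kj => (u kj.1 kj.2 : ℂ)) fun _ => (t : ℂ)) P

/-- `S u t` holds for all `(u, t)` with `q(u) = 1` in some nonempty Zariski open subset of the
(irreducible) variety of all `(u, t)` with `q(u) = 1`. -/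
def ForGenericParams (D : AffineStar) (S : D.Params → ℂˣ → Prop) : Prop :=
  ∃ P : MvPolynomial ((Σ k, Fin (D.d k)) ⊕ Unit) ℂ,
    (∃ u t, D.q u = 1 ∧ D.evalAt P u t ≠ 0) ∧
    ∀ u t, D.q u = 1 → D.evalAt P u t ≠ 0 → S u t

end AffineStar

/-- The index of the last element of a nonempty `ℓ`-tuple. -/
def lastIdx (ℓ : ℕ) [NeZero ℓ] : Fin ℓ := ⟨ℓ - 1, Nat.sub_lt (NeZero.pos ℓ) one_pos⟩

/-! ## The Ariki–Koike cyclotomic Hecke algebra `𝐇_{n,ℓ}(v,t)` -/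

namespace ArikiKoike

/-- Generators: `T_1, …, T_{n-1}`, their inverses, and `U`. -/
inductive Gen (n : ℕ) : Type
  | T (i : Fin (n - 1))
  | Tinv (i : Fin (n - 1))
  | U

abbrev Free (n : ℕ) : Type := FreeAlgebra ℂ (Gen n)

abbrev fT {n : ℕ} (i : Fin (n - 1)) : Free n := FreeAlgebra.ι ℂ (Gen.T i)
abbrev fTinv {n : ℕ} (i : Fin (n - 1)) : Free n := FreeAlgebra.ι ℂ (Gen.Tinv i)
abbrev fU {n : ℕ} : Free n := FreeAlgebra.ι ℂ Gen.U

/-- The defining relations. -/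
inductive Rel (n ℓ : ℕ) (v : Fin ℓ → ℂˣ) (t : ℂˣ) : Free n → Free n → Prop
  | T_mul_inv (i) : Rel n ℓ v t (fT i * fTinv i) 1
  | inv_mul_T (i) : Rel n ℓ v t (fTinv i * fT i) 1
  | braid (i j) (h : i.val + 1 = j.val) :
      Rel n ℓ v t (fT i * fT j * fT i) (fT j * fT i * fT j)
  | comm_TT (i j) (h : i.val + 1 < j.val ∨ j.val + 1 < i.val) :
      Rel n ℓ v t (fT i * fT j) (fT j * fT i)
  | comm_UT (i) (h : 0 < i.val) : Rel n ℓ v t (fU * fT i) (fT i * fU)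
  | UTUT (i) (h : i.val = 0) :
      Rel n ℓ v t (fU * fT i * fU * fT i) (fT i * fU * fT i * fU)
  | poly : Rel n ℓ v t (aeval fU (∏ j, (X - C (v j : ℂ)))) 0
  | quad (i) : Rel n ℓ v t (fT i - fTinv i) (algebraMap ℂ _ (t - (t : ℂ)⁻¹))

end ArikiKoike

/-- The Ariki–Koike algebra `𝐇_{n,ℓ}(v,t)` over `ℂ`. -/
abbrev ArikiKoike (n ℓ : ℕ) (v : Fin ℓ → ℂˣ) (t : ℂˣ) : Type :=
  RingQuot (ArikiKoike.Rel n ℓ v t)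

namespace ArikiKoike

variable (n ℓ : ℕ) (v : Fin ℓ → ℂˣ) (t : ℂˣ)

/-- The element `T_{i+1}` of the algebra. -/
def T (i : Fin (n - 1)) : ArikiKoike n ℓ v t := RingQuot.mkAlgHom ℂ (Rel n ℓ v t) (fT i)

/-- The element `U` of the algebra. -/
def U : ArikiKoike n ℓ v t := RingQuot.mkAlgHom ℂ (Rel n ℓ v t) fU

/-- The values of the trivial character on the generators: `T_i ↦ t`, `U ↦ v_ℓ`. -/
def charGen [NeZero ℓ] : Gen n → ℂ
  | .T _ => t
  | .Tinv _ => (t : ℂ)⁻¹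
  | .U => v (lastIdx ℓ)

/-- The trivial representation `χ : 𝐇_{n,ℓ}(v,t) → ℂ`, `χ(T_i) = t`, `χ(U) = v_ℓ`. -/
def triv [NeZero ℓ] : ArikiKoike n ℓ v t →ₐ[ℂ] ℂ :=
  RingQuot.liftAlgHom ℂ ⟨FreeAlgebra.lift ℂ (charGen n ℓ v t), by
    intro x y h
    induction h with
    | poly =>
      rw [← Polynomial.aeval_algHom_apply]
      simp only [FreeAlgebra.lift_ι_apply, charGen, map_prod, map_zero]
      exact Finset.prod_eq_zero (Finset.mem_univ (lastIdx ℓ)) (by simp)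
    | _ => simp [charGen] <;> ring⟩

/-- The subalgebra `𝐇_{n-1,ℓ} ⊆ 𝐇_{n,ℓ}` generated by `U, T_1, …, T_{n-2}`. -/
def sub : Subalgebra ℂ (ArikiKoike n ℓ v t) :=
  Algebra.adjoin ℂ ({U n ℓ v t} ∪ {x | ∃ i : Fin (n - 1), i.val + 1 < n - 1 ∧ x = T n ℓ v t i})

end ArikiKoike

/-! ## The generalized double affine Hecke algebra `H_n(u,t)` -/

namespace GDAHA

/-- Generators: `U_1, …, U_m`, `T_1, …, T_{n-1}` and their inverses. -/
inductive Gen (m n : ℕ) : Type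
  | U (k : Fin m)
  | Uinv (k : Fin m)
  | T (i : Fin (n - 1))
  | Tinv (i : Fin (n - 1))

abbrev Free (m n : ℕ) : Type := FreeAlgebra ℂ (Gen m n)

abbrev fU {m n : ℕ} (k : Fin m) : Free m n := FreeAlgebra.ι ℂ (Gen.U k)
abbrev fUinv {m n : ℕ} (k : Fin m) : Free m n := FreeAlgebra.ι ℂ (Gen.Uinv k)
abbrev fT {m n : ℕ} (i : Fin (n - 1)) : Free m n := FreeAlgebra.ι ℂ (Gen.T i)
abbrev fTinv {m n : ℕ} (i : Fin (n - 1)) : Free m n := FreeAlgebra.ι ℂ (Gen.Tinv i)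

/-- The defining relations. -/
inductive Rel (D : AffineStar) (n : ℕ) (u : D.Params) (t : ℂˣ) :
    Free D.m n → Free D.m n → Prop
  | U_mul_inv (k) : Rel D n u t (fU k * fUinv k) 1
  | inv_mul_U (k) : Rel D n u t (fUinv k * fU k) 1
  | T_mul_inv (i) : Rel D n u t (fT i * fTinv i) 1
  | inv_mul_T (i) : Rel D n u t (fTinv i * fT i) 1
  /-- `(U_1 ⋯ U_m) (T_1 ⋯ T_{n-2} T_{n-1}^2 T_{n-2} ⋯ T_1) = 1` -/
  | sphere : Rel D n u t ((List.ofFn fU).prod * (ascProd fT * descProd fT)) 1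
  | braid (i j) (h : i.val + 1 = j.val) :
      Rel D n u t (fT i * fT j * fT i) (fT j * fT i * fT j)
  | comm_TT (i j) (h : i.val + 1 < j.val ∨ j.val + 1 < i.val) :
      Rel D n u t (fT i * fT j) (fT j * fT i)
  | comm_UT (k i) (h : 0 < i.val) : Rel D n u t (fU k * fT i) (fT i * fU k)
  /-- `[U_j, T_1 U_j T_1] = 0` -/
  | UTUT (j i) (h : i.val = 0) :
      Rel D n u t (fU j * (fT i * fU j * fT i)) ((fT i * fU j * fT i) * fU j)
  /-- `[U_k, T_1⁻¹ U_j T_1] = 0` for `k < j` -/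
  | mixed (k j) (hkj : k < j) (i) (h : i.val = 0) :
      Rel D n u t (fU k * (fTinv i * fU j * fT i)) ((fTinv i * fU j * fT i) * fU k)
  | poly (k) : Rel D n u t (aeval (fU k) (∏ j, (X - C (u k j : ℂ)))) 0
  | quad (i) : Rel D n u t (fT i - fTinv i) (algebraMap ℂ _ (t - (t : ℂ)⁻¹))

end GDAHA

/-- The generalized double affine Hecke algebra `H_n(u,t)` of rank `n` attached to `D`, for
complex parameters `(u,t)`. -/
abbrev GDAHA (D : AffineStar) (n : ℕ) (u : D.Params) (t : ℂˣ) : Type :=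
  RingQuot (GDAHA.Rel D n u t)

namespace GDAHA

variable (D : AffineStar) (n : ℕ) (u : D.Params) (t : ℂˣ)

def U (k : Fin D.m) : GDAHA D n u t := RingQuot.mkAlgHom ℂ (Rel D n u t) (fU k)

/-- The element `T_{i+1}` of the algebra. -/
def T (i : Fin (n - 1)) : GDAHA D n u t := RingQuot.mkAlgHom ℂ (Rel D n u t) (fT i)

def Tinv (i : Fin (n - 1)) : GDAHA D n u t := RingQuot.mkAlgHom ℂ (Rel D n u t) (fTinv i)

/-- The images of the generators of the Ariki–Koike algebra in `H_n(u,t)`. -/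
def etaGen : ArikiKoike.Gen n → GDAHA D n u t
  | .T i => T D n u t i
  | .Tinv i => Tinv D n u t i
  | .U => U D n u t D.lastLeg

variable {D n u t}

theorem mk_rel {x y : Free D.m n} (h : Rel D n u t x y) :
    RingQuot.mkAlgHom ℂ (Rel D n u t) x = RingQuot.mkAlgHom ℂ (Rel D n u t) y :=
  RingQuot.mkAlgHom_rel ℂ h

theorem T_mul_Tinv (i) : T D n u t i * Tinv D n u t i = 1 := by
  simpa [T, Tinv] using mk_rel (Rel.T_mul_inv (D := D) (u := u) (t := t) i)

theorem Tinv_mul_T (i) : Tinv D n u t i * T D n u t i = 1 := by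
  simpa [T, Tinv] using mk_rel (Rel.inv_mul_T (D := D) (u := u) (t := t) i)

theorem T_braid (i j : Fin (n - 1)) (h : i.val + 1 = j.val) :
    T D n u t i * T D n u t j * T D n u t i = T D n u t j * T D n u t i * T D n u t j := by
  simpa [T] using mk_rel (Rel.braid (D := D) (u := u) (t := t) i j h)

theorem T_comm (i j : Fin (n - 1)) (h : i.val + 1 < j.val ∨ j.val + 1 < i.val) :
    T D n u t i * T D n u t j = T D n u t j * T D n u t i := by
  simpa [T] using mk_rel (Rel.comm_TT (D := D) (u := u) (t := t) i j h)

theorem U_T_comm (k) (i : Fin (n - 1)) (h : 0 < i.val) :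
    U D n u t k * T D n u t i = T D n u t i * U D n u t k := by
  simpa [T, U] using mk_rel (Rel.comm_UT (D := D) (u := u) (t := t) k i h)

theorem U_TUT (k) (i : Fin (n - 1)) (h : i.val = 0) :
    U D n u t k * (T D n u t i * U D n u t k * T D n u t i) =
      (T D n u t i * U D n u t k * T D n u t i) * U D n u t k := by
  simpa [T, U] using mk_rel (Rel.UTUT (D := D) (u := u) (t := t) k i h)

theorem U_mixed (k j) (hkj : k < j) (i : Fin (n - 1)) (h : i.val = 0) :
    U D n u t k * (Tinv D n u t i * U D n u t j * T D n u t i) =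
      (Tinv D n u t i * U D n u t j * T D n u t i) * U D n u t k := by
  simpa [T, U, Tinv] using mk_rel (Rel.mixed (D := D) (u := u) (t := t) k j hkj i h)

variable (D n u t)

/-- The homomorphism `η_m : 𝐇_{n,ℓ}(u_m,t) → H_n(u,t)`, `T_i ↦ T_i`, `U ↦ U_m`. -/
def eta : ArikiKoike n D.ell (u D.lastLeg) t →ₐ[ℂ] GDAHA D n u t :=
  RingQuot.liftAlgHom ℂ ⟨FreeAlgebra.lift ℂ (etaGen D n u t), by
    intro x y h
    induction h with
    | T_mul_inv i => simpa [etaGen] using T_mul_Tinv i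
    | inv_mul_T i => simpa [etaGen] using Tinv_mul_T i
    | braid i j h => simpa [etaGen] using T_braid i j h
    | comm_TT i j h => simpa [etaGen] using T_comm i j h
    | comm_UT i h => simpa [etaGen] using U_T_comm D.lastLeg i h
    | UTUT i h =>
      have := U_TUT (D := D) (u := u) (t := t) D.lastLeg i h
      simpa [etaGen, mul_assoc] using this
    | poly =>
      have := mk_rel (Rel.poly (D := D) (n := n) (u := u) (t := t) D.lastLeg)
      rw [← Polynomial.aeval_algHom_apply, map_zero] at this ⊢
      rw [FreeAlgebra.lift_ι_apply]
      exact this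
    | quad i =>
      have := mk_rel (Rel.quad (D := D) (u := u) (t := t) i)
      rw [AlgHom.commutes, map_sub] at this ⊢
      rw [FreeAlgebra.lift_ι_apply, FreeAlgebra.lift_ι_apply]
      exact this⟩

/-- `Ũ_k = T_{n-1} ⋯ T_1 U_k T_1⁻¹ ⋯ T_{n-1}⁻¹` for `k < m`, and
`Ũ_m = T_{n-1} ⋯ T_1 U_m T_1 ⋯ T_{n-1}`. -/
def tildeU (k : Fin D.m) : GDAHA D n u t :=
  if k = D.lastLeg then
    descProd (T D n u t) * U D n u t k * ascProd (T D n u t)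
  else
    descProd (T D n u t) * U D n u t k * ascProd (Tinv D n u t)

variable {D n u t}

theorem commute_zeroConj {N : ℕ} {A : Type*} [Monoid A] (T : Fin (N + 1) → A) (S : Fin (N + 1) → A)
    (x y : A) (hx : ∀ i : Fin (N + 1), 0 < i.val → Commute x (T i))
    (hS : ∀ i : Fin (N + 1), 0 < i.val → Commute x (S i))
    (h : Commute x (T 0 * y * S 0)) : Commute x (descProd T * y * ascProd S) := by
  have e : descProd T * y * ascProd S = descProd (fun i => T i.succ) * (T 0 * y * S 0) *
      ascProd (fun i => S i.succ) := by
    rw [descProd_succ, ascProd_succ]; simp only [mul_assoc]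
  rw [e]
  exact ((commute_descProd _ _ fun i => hx _ (by simp)).mul_right h).mul_right
    (commute_ascProd _ _ fun i => hS _ (by simp))

theorem U_Tinv_comm (k) (i : Fin (n - 1)) (h : 0 < i.val) :
    Commute (U D n u t k) (Tinv D n u t i) := by
  have h1 : Commute (U D n u t k) (T D n u t i) := U_T_comm k i h
  have e : Tinv D n u t i = ((⟨T D n u t i, Tinv D n u t i, T_mul_Tinv i, Tinv_mul_T i⟩ :
    (GDAHA D n u t)ˣ)⁻¹ : (GDAHA D n u t)ˣ) := rfl
  rw [e]
  exact Commute.units_inv_right (by exact h1)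

theorem commute_T_tildeU (k) (i : Fin (n - 1)) (hi : i.val + 1 < n - 1) :
    Commute (T D n u t i) (tildeU D n u t k) := by
  set j : Fin (n - 1) := ⟨i.val + 1, hi⟩ with hj
  have hd := mul_descProd (T D n u t) T_braid T_comm i j rfl
  have ha := ascProd_mul (T D n u t) T_braid T_comm i j rfl
  have hU := U_T_comm (D := D) (u := u) (t := t) k j (by simp [hj])
  have h1 := descProd_mul_ascProd (T D n u t) (Tinv D n u t) T_mul_Tinv
  have h2 := ascProd_mul_descProd (T D n u t) (Tinv D n u t) Tinv_mul_T
  have ha' : ascProd (Tinv D n u t) * T D n u t i = T D n u t j * ascProd (Tinv D n u t) := by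
    calc _ = ascProd (Tinv D n u t) * (T D n u t i * descProd (T D n u t)) *
            ascProd (Tinv D n u t) := by
          rw [mul_assoc, mul_assoc, h1, mul_one]
      _ = _ := by rw [hd, ← mul_assoc, h2, one_mul]
  unfold tildeU Commute SemiconjBy
  split_ifs
  · rw [← mul_assoc, ← mul_assoc, hd, mul_assoc _ (T D n u t j), ← hU, mul_assoc _ _ (T D n u t i),
      ha]
    simp only [mul_assoc]
  · rw [← mul_assoc, ← mul_assoc, hd, mul_assoc _ (T D n u t j), ← hU, mul_assoc _ _ (T D n u t i),
      ha']
    simp only [mul_assoc]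

theorem commute_U_tildeU (hn : 2 ≤ n) (k) :
    Commute (U D n u t D.lastLeg) (tildeU D n u t k) := by
  obtain ⟨N, rfl⟩ : ∃ N, n = N + 2 := ⟨n - 2, by omega⟩
  unfold tildeU
  have hz : ((0 : Fin (N + 1)) : ℕ) = 0 := rfl
  split_ifs with hk
  · subst hk
    exact commute_zeroConj (N := N) _ _ _ _ (fun i hi => U_T_comm _ _ hi)
      (fun i hi => U_T_comm _ _ hi) (U_TUT (n := N + 2) D.lastLeg (0 : Fin (N + 1)) hz)
  · refine commute_zeroConj (N := N) _ _ _ _ (fun i hi => U_T_comm _ _ hi)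
      (fun i hi => U_Tinv_comm _ _ hi) ?_
    have hm := U_mixed (D := D) (n := N + 2) (u := u) (t := t) k D.lastLeg
      (lt_of_le_of_ne (Fin.le_last k) hk) (0 : Fin (N + 1)) hz
    have h1 := T_mul_Tinv (D := D) (n := N + 2) (u := u) (t := t) (0 : Fin (N + 1))
    set a := T D (N + 2) u t (0 : Fin (N + 1))
    set b := Tinv D (N + 2) u t (0 : Fin (N + 1))
    set x := U D (N + 2) u t k
    set y := U D (N + 2) u t D.lastLeg
    change y * (a * x * b) = a * x * b * y
    calc y * (a * x * b) = (a * b) * y * (a * x * b) := by rw [h1, one_mul]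
      _ = a * ((b * y * a) * x) * b := by simp only [mul_assoc]
      _ = a * (x * (b * y * a)) * b := by rw [hm]
      _ = a * x * b * y * (a * b) := by simp only [mul_assoc]
      _ = a * x * b * y := by rw [h1, mul_one]

/-- `Ũ_k` commutes with `𝐇_{n-1,ℓ}`. -/
theorem commute_eta_tildeU (hn : 2 ≤ n) (k) (h : ArikiKoike n D.ell (u D.lastLeg) t)
    (hh : h ∈ ArikiKoike.sub n D.ell (u D.lastLeg) t) :
    Commute (eta D n u t h) (tildeU D n u t k) := by
  have hU : eta D n u t (ArikiKoike.U n D.ell (u D.lastLeg) t) = U D n u t D.lastLeg := by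
    simp only [eta, ArikiKoike.U, RingQuot.liftAlgHom_mkAlgHom_apply, FreeAlgebra.lift_ι_apply,
      etaGen]
  have hT (i) : eta D n u t (ArikiKoike.T n D.ell (u D.lastLeg) t i) = T D n u t i := by
    simp only [eta, ArikiKoike.T, RingQuot.liftAlgHom_mkAlgHom_apply, FreeAlgebra.lift_ι_apply,
      etaGen]
  unfold ArikiKoike.sub at hh
  induction hh using Algebra.adjoin_induction with
  | mem x hx =>
    rcases hx with rfl | ⟨i, hi, rfl⟩
    · rw [hU]; exact commute_U_tildeU hn k
    · rw [hT]; exact commute_T_tildeU k i hi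
  | algebraMap c => rw [AlgHom.commutes]; exact Algebra.commutes _ _
  | add x y _ _ hx hy => rw [map_add]; exact hx.add_left hy
  | mul x y _ _ hx hy => rw [map_mul]; exact hx.mul_left hy

end GDAHA

/-! ## The set `ℝ_{n,u,t}` of irreducible representations -/

/-- An irreducible representation of `H_n(u,t)` whose restriction along `η_m` is isomorphic to the
regular representation of `𝐇_{n,ℓ}(u_m,t)`. -/
structure RegularIrrep (D : AffineStar) (n : ℕ) (u : D.Params) (t : ℂˣ) where
  carrier : Type
  [addCommGroup : AddCommGroup carrier]
  [moduleC : Module ℂ carrier]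
  [moduleH : Module (GDAHA D n u t) carrier]
  [isScalarTower : IsScalarTower ℂ (GDAHA D n u t) carrier]
  irreducible : IsSimpleModule (GDAHA D n u t) carrier
  regular : ∃ φ : ArikiKoike n D.ell (u D.lastLeg) t ≃ₗ[ℂ] carrier,
    ∀ a b, φ (a * b) = GDAHA.eta D n u t a • φ b

namespace RegularIrrep

variable {D : AffineStar} {n : ℕ} {u : D.Params} {t : ℂˣ}

attribute [instance] addCommGroup moduleC moduleH isScalarTower

/-- Isomorphism of representations of `H_n(u,t)`. -/
instance setoid (D : AffineStar) (n : ℕ) (u : D.Params) (t : ℂˣ) :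
    Setoid (RegularIrrep D n u t) where
  r V W := Nonempty (V.carrier ≃ₗ[GDAHA D n u t] W.carrier)
  iseqv := ⟨fun _ => ⟨LinearEquiv.refl _ _⟩, fun ⟨e⟩ => ⟨e.symm⟩, fun ⟨e⟩ ⟨f⟩ => ⟨e.trans f⟩⟩

/-- `V' = V^{𝐇_{n-1,ℓ}}`: the vectors on which `𝐇_{n-1,ℓ}` acts through the trivial
representation `χ`. -/
def primeSpace (V : RegularIrrep D n u t) : Submodule ℂ V.carrier where
  carrier := {x | ∀ h ∈ ArikiKoike.sub n D.ell (u D.lastLeg) t,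
    GDAHA.eta D n u t h • x = ArikiKoike.triv n D.ell (u D.lastLeg) t h • x}
  zero_mem' := fun h _ => by simp
  add_mem' := fun {x y} hx hy h hh => by rw [smul_add, smul_add, hx h hh, hy h hh]
  smul_mem' := fun c x hx h hh => by rw [smul_comm, hx h hh, smul_comm]

theorem tildeU_mem (hn : 2 ≤ n) (V : RegularIrrep D n u t) (k : Fin D.m) (x : V.carrier)
    (hx : x ∈ V.primeSpace) : Algebra.lsmul ℂ ℂ V.carrier (GDAHA.tildeU D n u t k) x ∈
      V.primeSpace := by
  intro h hh
  rw [Algebra.lsmul_coe, smul_smul, (GDAHA.commute_eta_tildeU hn k h hh).eq, mul_smul, hx h hh,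
    smul_comm]

/-- The operator `Ũ_k|_{V'}`. -/
def tildeU (hn : 2 ≤ n) (V : RegularIrrep D n u t) (k : Fin D.m) :
    V.primeSpace →ₗ[ℂ] V.primeSpace :=
  (Algebra.lsmul ℂ ℂ V.carrier (GDAHA.tildeU D n u t k)).restrict (V.tildeU_mem hn k)

end RegularIrrep

/-- The set `ℝ_{n,u,t}` of isomorphism classes of irreducible representations of `H_n(u,t)` whose
restriction along `η_m` is the regular representation. -/
abbrev IrrepClasses (D : AffineStar) (n : ℕ) (u : D.Params) (t : ℂˣ) : Type 1 :=
  Quotient (RegularIrrep.setoid D n u t)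

/-! ## The multiplicative Deligne–Simpson variety `𝕄_{n,u,t}` -/

/-- `X ∼ Y`: the matrices `X` and `Y` are conjugate (up to an identification of the index sets,
i.e. they represent the same operator in two bases). -/
def SimilarMatrices {I J : Type*} [Fintype I] [Fintype J] [DecidableEq I] [DecidableEq J]
    (X : Matrix I I ℂ) (Y : Matrix J J ℂ) : Prop :=
  ∃ (P : Matrix I J ℂ) (Q : Matrix J I ℂ), P * Q = 1 ∧ Q * P = 1 ∧ X = P * Y * Q

/-- The matrix `T` with `T_{ij} = 1 - δ_{ij}`. -/
def matT (n : ℕ) : Matrix (Fin n) (Fin n) ℂ := Matrix.of fun i j => if i = j then 0 else 1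

/-- `t^{2T} = exp(2 log(t) T)`. As `T` is diagonalizable with integer eigenvalues, this does not
depend on the branch of the logarithm. -/
def powTwoT (n : ℕ) (t : ℂˣ) : Matrix (Fin n) (Fin n) ℂ :=
  NormedSpace.exp ((2 * Complex.log t) • matT n)

/-- `diag(w_1, …, w_d) ⊗ Id_N`. -/
def diagTensorId {d : ℕ} (w : Fin d → ℂ) (N : ℕ) : Matrix (Fin d × Fin N) (Fin d × Fin N) ℂ :=
  Matrix.diagonal w ⊗ₖ (1 : Matrix (Fin N) (Fin N) ℂ)

/-- The set of tuples `(X_1, …, X_m) ∈ GL_{nℓ}(ℂ)^m` with `X_1 ⋯ X_m = 1`,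
`X_k ∼ diag(u_{k1}, …, u_{kd_k}) ⊗ Id_{nℓ/d_k}` for `k < m`, and
`X_m ∼ u_{mℓ} t^{2T} ⊕ diag(u_{m1}, …, u_{m,ℓ-1}) ⊗ Id_n`. -/
structure DSTuple (D : AffineStar) (n : ℕ) (u : D.Params) (t : ℂˣ) where
  X : Fin D.m → GL (Fin (n * D.ell)) ℂ
  prod_eq_one : (List.ofFn X).prod = 1
  similar : ∀ k, k ≠ D.lastLeg →
    SimilarMatrices (X k).val (diagTensorId (fun j => (u k j : ℂ)) (n * D.ell / D.d k))
  similar_last : SimilarMatrices (X D.lastLeg).val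
    (Matrix.fromBlocks ((u D.lastLeg (lastIdx D.ell) : ℂ) • powTwoT n t) 0 0
      (diagTensorId
        (fun j : Fin (D.ell - 1) => (u D.lastLeg (j.castLE (Nat.sub_le _ 1)) : ℂ)) n))

/-- Simultaneous conjugation. -/
instance DSTuple.setoid (D : AffineStar) (n : ℕ) (u : D.Params) (t : ℂˣ) :
    Setoid (DSTuple D n u t) where
  r X Y := ∃ g : GL (Fin (n * D.ell)) ℂ, ∀ k, Y.X k = g * X.X k * g⁻¹
  iseqv :=
    ⟨fun X => ⟨1, fun k => by simp⟩,
      fun ⟨g, h⟩ => ⟨g⁻¹, fun k => by rw [h]; group⟩,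
      fun ⟨g, h⟩ ⟨g', h'⟩ => ⟨g' * g, fun k => by rw [h', h]; group⟩⟩

/-- The set `𝕄_{n,u,t}` of (simultaneous) conjugacy classes of such tuples. -/
abbrev DSVariety (D : AffineStar) (n : ℕ) (u : D.Params) (t : ℂˣ) : Type :=
  Quotient (DSTuple.setoid D n u t)

end

noncomputable section

/-! ## Intertwiners in rank two -/

/-! The tuple of operators `Ũ_k` on `V'` has product one because the `Ũ_k` with `k < m` are
simultaneous conjugates of the `U_k`, and the remaining factors close up to the sphere relation
(`GDAHA.prod_tildeU`). What needs work is the conjugacy class of each operator: it must be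
diagonalizable with the prescribed eigenvalues and multiplicities.

Eigenvalues. For `k < m` the polynomial relation of `U_k` is inherited by conjugation. For `k = m`,
`Ũ_m` is the image of the last Jucys–Murphy element of the Ariki–Koike algebra, and regularity of
`V` identifies `V'` with the invariants of left multiplication by `𝐇_{n-1,ℓ}` on `𝐇_{n,ℓ}`. Write
`L_k` for the Jucys–Murphy elements, `v` for `u_{mℓ}` and `F` for the product of the other factors
`X - u_{mj}`. Intertwiners show by induction on `k` that for `k ≥ 1`, on the invariants of level
`k`, `L_k` is annihilated by `(X - v t^{2k})(X - v t^{-2}) F` (`HeckeRelations.aeval_jm`). These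
roots are distinct for generic parameters, and they are the eigenvalues occurring in `v t^{2T} ⊕
diag(u_{m1}, …, u_{m,ℓ-1}) ⊗ Id`.

Multiplicities. No dimension formula for the Ariki–Koike algebra is used, only the crude bounds `0 <
dim V' ≤ n(ℓ+1)` (`HeckeRelations.exists_inv`, `HeckeRelations.invariants_finite`). The determinant
of `Ũ_1 ⋯ Ũ_m = 1` is a Laurent monomial in `u` and `t` with value `1`, whose exponents are built
from the multiplicities. For generic parameters with `q(u) = 1` only powers of `q` can take the
value `1`, so all multiplicities are determined by a single integer `a`, and `dim V' = a n ℓ`. The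
crude bounds then force `a = 1` (`RegularIrrep.finrank_eigenspaces`).

A change of basis or an isomorphism of representations conjugates the tuple, so it defines a map on
classes. -/

theorem aeval_semiconj {A : Type*} [Ring A] [Algebra ℂ A] {τ x y : A} (h : τ * x = y * τ)
    (p : ℂ[X]) : τ * aeval x p = aeval y p * τ := by
  induction p using Polynomial.induction_on' with
  | add p q hp hq => rw [map_add, map_add, mul_add, add_mul, hp, hq]
  | monomial k c =>
    have hk : SemiconjBy τ (x ^ k) (y ^ k) := SemiconjBy.pow_right h k
    rw [aeval_monomial, aeval_monomial, ← mul_assoc, ← Algebra.commutes c τ, mul_assoc, hk.eq,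
      mul_assoc]

theorem aeval_mul_of_mul_eq_smul {A : Type*} [Ring A] [Algebra ℂ A] {L x : A} {a : ℂ}
    (h : L * x = a • x) (p : ℂ[X]) : aeval L p * x = p.eval a • x := by
  induction p using Polynomial.induction_on' with
  | add p q hp hq => rw [map_add, add_mul, hp, hq, eval_add, add_smul]
  | monomial k c =>
    have hk : L ^ k * x = a ^ k • x := by
      induction k with
      | zero => simp
      | succ k ih => rw [pow_succ, mul_assoc, h, mul_smul_comm, ih, smul_smul, pow_succ']
    rw [aeval_monomial, eval_monomial, mul_assoc, hk, ← Algebra.smul_def, smul_smul]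

/-- This is the form in which the nonvanishing conditions on the parameters enter the argument: an
eigenvalue that is not a root of an annihilating polynomial does not occur. -/
theorem eq_zero_of_aeval_mul {A : Type*} [Ring A] [Algebra ℂ A] {L x : A} {a : ℂ}
    (h : L * x = a • x) {p : ℂ[X]} (hp : aeval L p * x = 0) (ha : p.eval a ≠ 0) : x = 0 := by
  rw [aeval_mul_of_mul_eq_smul h] at hp
  exact (smul_eq_zero.1 hp).resolve_left ha

section RankTwo

variable {A : Type*} [Ring A] [Algebra ℂ A] {t : ℂ} {L L' T : A}

/-- The intertwiner of the commuting elements `L` and `L' = T L T`. -/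
def intertwiner (t : ℂ) (L L' T : A) : A := T * (L - L') + (t - t⁻¹) • L'

theorem mul_of_quad (hq : T * T = (t - t⁻¹) • T + 1) (hL : L' = T * L * T) :
    L' * T = T * L + (t - t⁻¹) • L' := by
  have : L' * T = T * L * (T * T) := by rw [hL, mul_assoc]
  rw [this, hq, mul_add, mul_one, mul_smul_comm, ← hL, add_comm]

theorem mul_of_quad' (hq : T * T = (t - t⁻¹) • T + 1) (hL : L' = T * L * T) :
    T * L' = L * T + (t - t⁻¹) • L' := by
  have : T * L' = (T * T) * (L * T) := by rw [hL]; simp only [mul_assoc]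
  rw [this, hq, add_mul, one_mul, smul_mul_assoc, ← mul_assoc, ← hL, add_comm]

/-- `T` alone fails to intertwine, by `T L' = L T + (t - t⁻¹) L'`; the second summand of the
intertwiner cancels this error once `L` and `L'` commute. -/
theorem intertwiner_mul_right (hq : T * T = (t - t⁻¹) • T + 1) (hL : L' = T * L * T)
    (hc : L * L' = L' * L) : intertwiner t L L' T * L' = L * intertwiner t L L' T := by
  have h2 : L * T = T * L' - (t - t⁻¹) • L' := by rw [mul_of_quad' hq hL]; abel
  have e : L * intertwiner t L L' T = (L * T) * (L - L') + (t - t⁻¹) • (L * L') := by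
    rw [intertwiner, mul_add, mul_smul_comm, mul_assoc]
  rw [e, h2, intertwiner]
  simp only [add_mul, sub_mul, mul_sub, smul_mul_assoc, mul_assoc, hc]
  abel

/-- The right side is `-(L - t² L')(L - t⁻² L')`. Where the square vanishes and `L` acts by `a`, it
is therefore a quadratic equation for `L'` with roots `a t²` and `a t⁻²`. -/
theorem intertwiner_sq (ht : t ≠ 0) (hq : T * T = (t - t⁻¹) • T + 1) (hL : L' = T * L * T)
    (hc : L * L' = L' * L) : intertwiner t L L' T * intertwiner t L L' T =
      -(L * L - (t ^ 2 + (t ^ 2)⁻¹) • (L * L') + L' * L') := by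
  set h := t - t⁻¹ with hh
  have h2 : L * T = T * L' - h • L' := by rw [mul_of_quad' hq hL]; abel
  have h1 := mul_of_quad hq hL
  have hs : t ^ 2 + (t ^ 2)⁻¹ = h * h + 2 := by rw [hh]; field_simp; ring
  have e1 : (L - L') * T = T * L' - T * L - (2 * h) • L' := by
    rw [sub_mul, h2, h1, two_mul, add_smul]; abel
  have e2 : intertwiner t L L' T * T = -(h • (T * L')) + (h * h) • L' - L + L' := by
    rw [intertwiner, add_mul, mul_assoc, e1, mul_sub, mul_sub, ← mul_assoc, ← mul_assoc, hq,
      smul_mul_assoc, h1]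
    simp only [add_mul, one_mul, smul_mul_assoc, mul_smul_comm, smul_add, smul_smul, two_mul,
      add_smul, mul_add, ← hh]
    abel
  have e3 : intertwiner t L L' T * intertwiner t L L' T =
      (intertwiner t L L' T * T) * (L - L') + h • (intertwiner t L L' T * L') := by
    conv_lhs => rw [intertwiner.eq_1 t L L' T, mul_add, mul_smul_comm, ← intertwiner.eq_1,
      ← mul_assoc]
  rw [e3, e2, hs, intertwiner]
  simp only [add_mul, sub_mul, mul_sub, smul_mul_assoc, mul_assoc, hc, smul_sub, neg_mul, smul_add,
    smul_smul, add_smul, two_smul, ← hh]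
  abel

/-- If the intertwiner kills a joint eigenvector with `a ≠ b`, this formula makes `T x` an explicit
multiple of `x`. -/
theorem intertwiner_mul_eq {x : A} {a b : ℂ} (hL : L * x = a • x) (hL' : L' * x = b • x) :
    intertwiner t L L' T * x = (a - b) • (T * x) + ((t - t⁻¹) * b) • x := by
  rw [intertwiner, add_mul, mul_assoc, sub_mul, hL, hL', ← sub_smul, mul_smul_comm, smul_mul_assoc,
    hL', smul_smul]

end RankTwo

/-! ## Hecke relations and Jucys–Murphy elements -/

/-- Elements `U, T_0, …, T_{N-1}` satisfying the relations of an Ariki–Koike algebra, where the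
polynomial satisfied by `U` is `(X - v) F`. -/
structure HeckeRelations {A : Type*} [Ring A] [Algebra ℂ A] (N : ℕ) (t v : ℂ) (F : ℂ[X])
    (T : ℕ → A) (U : A) : Prop where
  quad : ∀ i < N, T i * T i = (t - t⁻¹) • T i + 1
  braid : ∀ i, i + 1 < N → T i * T (i + 1) * T i = T (i + 1) * T i * T (i + 1)
  comm : ∀ i j, i + 1 < j → j < N → T i * T j = T j * T i
  comm_U : ∀ i, 0 < i → i < N → U * T i = T i * U
  UTUT : 0 < N → U * T 0 * U * T 0 = T 0 * U * T 0 * U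
  poly : aeval U ((X - C v) * F) = 0

/-- Nonvanishing conditions on the parameters. -/
structure HeckeGeneric (N : ℕ) (t v : ℂ) (F : ℂ[X]) : Prop where
  t_ne : t ≠ 0
  v_ne : v ≠ 0
  t_pow : ∀ j, 0 < j → j ≤ N + 2 → t ^ (2 * j) ≠ 1
  F_eval : ∀ j, j ≤ N + 1 → F.eval (v * t ^ (2 * j)) ≠ 0

/-- The Jucys–Murphy elements. -/
def jucysMurphy {A : Type*} [Ring A] (T : ℕ → A) (U : A) : ℕ → A
  | 0 => U
  | i + 1 => T i * jucysMurphy T U i * T i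

/-- The quotient of the minimal polynomial of the `k`-th Jucys–Murphy element on the invariants by
the factor `X - v t^{2k}`. -/
def jmCofactor (t v : ℂ) (F : ℂ[X]) : ℕ → ℂ[X]
  | 0 => F
  | _ + 1 => (X - C (v * (t ^ 2)⁻¹)) * F

/-- The minimal polynomial of the `k`-th Jucys–Murphy element on the invariants. -/
def jmPoly (t v : ℂ) (F : ℂ[X]) (k : ℕ) : ℂ[X] := (X - C (v * t ^ (2 * k))) * jmCofactor t v F k

/-- `x` is an eigenvector, for left multiplication by `U, T_0, …, T_{k-2}`, of the trivial
character. -/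
def IsHeckeInvariant {A : Type*} [Ring A] [Algebra ℂ A] (t v : ℂ) (T : ℕ → A) (U : A) (k : ℕ)
    (x : A) : Prop :=
  (0 < k → U * x = v • x) ∧ ∀ i, i + 1 < k → T i * x = t • x

namespace HeckeRelations

variable {A : Type*} [Ring A] [Algebra ℂ A] {N : ℕ} {t v : ℂ} {F : ℂ[X]} {T : ℕ → A} {U : A}

local notation "JM" => jucysMurphy T U
local notation "Inv" => IsHeckeInvariant t v T U

/-- The relations are symmetric under reversal of words, so results on left invariants also give
results on right invariants. -/
theorem op (H : HeckeRelations N t v F T U) :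
    HeckeRelations N t v F (fun i => MulOpposite.op (T i)) (MulOpposite.op U) where
  quad i hi := by
    rw [← MulOpposite.op_mul, H.quad i hi]; simp
  braid i hi := by
    simp only [← MulOpposite.op_mul, ← mul_assoc]; rw [H.braid i hi]
  comm i j hij hj := by
    simp only [← MulOpposite.op_mul]; rw [H.comm i j hij hj]
  comm_U i hi hN := by
    simp only [← MulOpposite.op_mul]; rw [H.comm_U i hi hN]
  UTUT h := by
    simp only [← MulOpposite.op_mul, ← mul_assoc]; rw [H.UTUT h]
  poly := by
    have key (p : ℂ[X]) : aeval (MulOpposite.op U) p = MulOpposite.op (aeval U p) := by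
      induction p using Polynomial.induction_on' with
      | add p q hp hq => rw [map_add, map_add, hp, hq, MulOpposite.op_add]
      | monomial k c =>
        rw [aeval_monomial, aeval_monomial, MulOpposite.op_mul, MulOpposite.op_pow,
          ← MulOpposite.algebraMap_apply, Algebra.commutes]
    rw [key, H.poly, MulOpposite.op_zero]

theorem jm_commute_T_of_lt (H : HeckeRelations N t v F T U) (i j : ℕ) (hij : i < j) (hj : j < N) :
    Commute (JM i) (T j) := by
  induction i with
  | zero => exact H.comm_U j hij hj
  | succ i ih =>
    have h1 : Commute (T i) (T j) := H.comm i j hij hj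
    exact (h1.mul_left (ih (by omega))).mul_left h1

/-- Only `i = j + 2` needs an argument: there `L_{j+2} = T_{j+1} T_j L_j T_j T_{j+1}`, and two braid
moves carry `T_j` across, since `T_{j+1}` commutes with `L_j`. -/
theorem jm_commute_T_of_gt (H : HeckeRelations N t v F T U) (i j : ℕ) (hij : j + 1 < i)
    (hi : i ≤ N) : Commute (JM i) (T j) := by
  induction i with
  | zero => omega
  | succ i ih =>
    rcases Nat.lt_or_ge (j + 1) i with h | h
    · have h1 : Commute (T i) (T j) := (H.comm j i h (by omega)).symm
      exact (h1.mul_left (ih h (by omega))).mul_left h1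
    · obtain rfl : i = j + 1 := by omega
      have hb := H.braid j (by omega)
      have hc := (H.jm_commute_T_of_lt j (j + 1) (by omega) (by omega)).eq
      set a := T j
      set b := T (j + 1)
      set L := JM j
      change b * (a * L * a) * b * a = a * (b * (a * L * a) * b)
      calc b * (a * L * a) * b * a = b * a * L * (a * b * a) := by simp only [mul_assoc]
        _ = b * a * (L * b) * a * b := by rw [hb]; simp only [mul_assoc]
        _ = (b * a * b) * L * a * b := by rw [hc]; simp only [mul_assoc]
        _ = _ := by rw [← hb]; simp only [mul_assoc]

theorem jm_commute_U (H : HeckeRelations N t v F T U) (i : ℕ) (hi : i ≤ N) :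
    Commute (JM i) U := by
  induction i with
  | zero => exact Commute.refl U
  | succ i ih =>
    rcases Nat.eq_zero_or_pos i with rfl | h
    · have := H.UTUT (by omega)
      change T 0 * U * T 0 * U = U * (T 0 * U * T 0)
      rw [← this]; simp only [mul_assoc]
    · have h1 : Commute (T i) U := (H.comm_U i h (by omega)).symm
      exact (h1.mul_left (ih (by omega))).mul_left h1

theorem jm_commute_jm (H : HeckeRelations N t v F T U) (i j : ℕ) (hij : j < i) (hi : i ≤ N) :
    Commute (JM i) (JM j) := by
  induction j with
  | zero => exact H.jm_commute_U i hi
  | succ j ih =>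
    have h1 := H.jm_commute_T_of_gt i j hij hi
    exact (h1.mul_right (ih (by omega))).mul_right h1

end HeckeRelations

namespace IsHeckeInvariant

variable {A : Type*} [Ring A] [Algebra ℂ A] {N : ℕ} {t v : ℂ} {F : ℂ[X]} {T : ℕ → A} {U : A}

local notation "JM" => jucysMurphy T U
local notation "Inv" => IsHeckeInvariant t v T U

theorem mono {j k : ℕ} (hjk : j ≤ k) {x : A} (hx : Inv k x) : Inv j x :=
  ⟨fun h => hx.1 (by omega), fun i hi => hx.2 i (by omega)⟩

theorem mul_left {k : ℕ} {x y : A} (hx : Inv k x) (hU : 0 < k → Commute y U)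
    (hT : ∀ i, i + 1 < k → Commute y (T i)) : Inv k (y * x) :=
  ⟨fun h => by rw [← mul_assoc, ← (hU h).eq, mul_assoc, hx.1 h, mul_smul_comm],
    fun i hi => by rw [← mul_assoc, ← (hT i hi).eq, mul_assoc, hx.2 i hi, mul_smul_comm]⟩

theorem aeval_mul {k : ℕ} {x y : A} (hx : Inv k x) (hU : 0 < k → Commute y U)
    (hT : ∀ i, i + 1 < k → Commute y (T i)) (p : ℂ[X]) : Inv k (aeval y p * x) :=
  hx.mul_left (fun h => (aeval_semiconj (hU h).symm.eq p).symm)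
    fun i hi => (aeval_semiconj (hT i hi).symm.eq p).symm

/-- Each `T` in the palindromic word `L_i` contributes a factor `t`, and the central `U` contributes
`v`. -/
theorem jm_mul_eq {k : ℕ} {x : A} (hx : Inv k x) (i : ℕ) (hi : i < k) :
    JM i * x = (v * t ^ (2 * i)) • x := by
  induction i with
  | zero => rw [jucysMurphy, hx.1 hi]; simp
  | succ i ih =>
    rw [jucysMurphy, mul_assoc, hx.2 i hi, mul_smul_comm, mul_assoc, ih (by omega), mul_smul_comm,
      hx.2 i hi, smul_smul, smul_smul]
    congr 1; ring

theorem smul_add_smul {k : ℕ} {x y : A} {a b : ℂ} (hx : Inv k x) (hy : Inv k y) :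
    Inv k (a • x + b • y) :=
  ⟨fun h => by
    rw [mul_add, mul_smul_comm, mul_smul_comm, hx.1 h, hy.1 h, smul_add, smul_comm a, smul_comm b],
   fun i hi => by
    rw [mul_add, mul_smul_comm, mul_smul_comm, hx.2 i hi, hy.2 i hi, smul_add, smul_comm a,
      smul_comm b]⟩

end IsHeckeInvariant

theorem eval_jmCofactor_succ (t v : ℂ) (F : ℂ[X]) (k : ℕ) (a : ℂ) :
    (jmCofactor t v F (k + 1)).eval a = (a - v * (t ^ 2)⁻¹) * F.eval a := by
  simp [jmCofactor]

theorem eval_jmPoly (t v : ℂ) (F : ℂ[X]) (k : ℕ) (a : ℂ) :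
    (jmPoly t v F k).eval a = (a - v * t ^ (2 * k)) * (jmCofactor t v F k).eval a := by
  simp [jmPoly]

namespace HeckeGeneric

variable {N : ℕ} {t v : ℂ} {F : ℂ[X]}

/-- The two numbers differ exactly when `t^{2(j+1)} ≠ 1`; this accounts for the range `N + 2` in the
condition on powers of `t`. -/
theorem sub_inv_ne (G : HeckeGeneric N t v F) (j : ℕ) (hj : j ≤ N + 1) :
    v * t ^ (2 * j) - v * (t ^ 2)⁻¹ ≠ 0 := by
  have ht := G.t_ne
  have h := G.t_pow (j + 1) (by omega) (by omega)
  rw [← mul_sub]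
  refine mul_ne_zero G.v_ne fun e => h ?_
  have : t ^ (2 * j) = (t ^ 2)⁻¹ := sub_eq_zero.1 e
  rw [mul_add, pow_add, this, mul_one, inv_mul_cancel₀ (pow_ne_zero 2 ht)]

theorem cofactor_eval (G : HeckeGeneric N t v F) (k j : ℕ) (hj : j ≤ N + 1) :
    (jmCofactor t v F k).eval (v * t ^ (2 * j)) ≠ 0 := by
  cases k with
  | zero => exact G.F_eval j hj
  | succ k =>
    rw [eval_jmCofactor_succ]
    exact mul_ne_zero (G.sub_inv_ne j hj) (G.F_eval j hj)

theorem t_sq (G : HeckeGeneric N t v F) : t ^ 2 ≠ 1 := G.t_pow 1 one_pos (by omega)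

theorem t_sq' (G : HeckeGeneric N t v F) : t ^ 2 + 1 ≠ 0 := fun h =>
  G.t_pow 2 two_pos (by omega) (by linear_combination (t ^ 2 - 1) * h)

theorem h_ne (G : HeckeGeneric N t v F) : t - t⁻¹ ≠ 0 := by
  intro e
  have ht := G.t_ne
  refine G.t_sq ?_
  field_simp at e
  linear_combination e

end HeckeGeneric

/-! ### Annihilating polynomials of Jucys–Murphy elements on invariants -/

theorem jucysMurphy_succ {A : Type*} [Ring A] (T : ℕ → A) (U : A) (i : ℕ) :
    jucysMurphy T U (i + 1) = T i * jucysMurphy T U i * T i := rfl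

namespace HeckeRelations

variable {A : Type*} [Ring A] [Algebra ℂ A] {N : ℕ} {t v : ℂ} {F : ℂ[X]} {T : ℕ → A} {U : A}

local notation "JM" => jucysMurphy T U
local notation "Inv" => IsHeckeInvariant t v T U

theorem inv_T_mul (H : HeckeRelations N t v F T U) {k : ℕ} (hk : k < N) {x : A} (hx : Inv k x) :
    Inv k (T k * x) :=
  hx.mul_left (fun h => (H.comm_U k h hk).symm) fun i hi => (H.comm i k hi hk).symm

theorem inv_aeval_jm_mul (H : HeckeRelations N t v F T U) {k : ℕ} (hk : k ≤ N) {x : A}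
    (hx : Inv k x) (p : ℂ[X]) : Inv k (aeval (JM k) p * x) :=
  hx.aeval_mul (fun _ => H.jm_commute_U k hk) (fun i hi => H.jm_commute_T_of_gt k i hi hk) p

/-- If `L_k x = a x` and `L_{k+1} x = b x` for an invariant `x` with `p_k(b) ≠ 0`, then the
intertwiner kills `x`. -/
theorem intertwiner_eq_zero (H : HeckeRelations N t v F T U) {k : ℕ} (hk : k < N)
    (hp : ∀ x, Inv k x → aeval (JM k) (jmPoly t v F k) * x = 0) {x : A} {a b : ℂ} (hx : Inv k x)
    (ha : JM k * x = a • x) (hb : JM (k + 1) * x = b • x) (hpb : (jmPoly t v F k).eval b ≠ 0) :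
    (a - b) • (T k * x) + ((t - t⁻¹) * b) • x = 0 := by
  have hc := (H.jm_commute_jm (k + 1) k (by omega) hk).symm.eq
  have hi : Inv k (intertwiner t (JM k) (JM (k + 1)) (T k) * x) := by
    rw [intertwiner_mul_eq ha hb]
    exact (H.inv_T_mul hk hx).smul_add_smul hx
  -- The intertwiner turns the eigenvalue `b` of `L_{k+1}` into an eigenvalue of `L_k`, where it
  -- would have to be a root of `p_k`.
  have he : JM k * (intertwiner t (JM k) (JM (k + 1)) (T k) * x) =
      b • (intertwiner t (JM k) (JM (k + 1)) (T k) * x) := by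
    rw [← mul_assoc, ← intertwiner_mul_right (H.quad k hk) (jucysMurphy_succ T U k) hc,
      mul_assoc, hb, mul_smul_comm]
  rw [← intertwiner_mul_eq ha hb]
  exact eq_zero_of_aeval_mul he (hp _ hi) hpb

/-- If `L_k` and `L_{k+1}` both act on `x` by `a`, then `(L_k - a) T_k x` is a nonzero multiple of
`x`. Thus `T_k x` would span a Jordan block with `x`, although `a` is only a simple root of `p_k`.
-/
theorem eq_zero_of_jm_eq_jm (H : HeckeRelations N t v F T U) (G : HeckeGeneric N t v F) {k : ℕ}
    (hk : k < N) (hp : ∀ x, Inv k x → aeval (JM k) (jmPoly t v F k) * x = 0) {x : A}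
    (hx : Inv (k + 1) x) (hb : JM (k + 1) * x = (v * t ^ (2 * k)) • x) : x = 0 := by
  set a := v * t ^ (2 * k) with ha
  have hLx : JM k * x = a • x := hx.jm_mul_eq k (by omega)
  have hx' := hx.mono (Nat.le_succ k)
  have ha0 : a ≠ 0 := mul_ne_zero G.v_ne (pow_ne_zero _ G.t_ne)
  have h1 : aeval (JM k) (X - C a) * (T k * x) = (-((t - t⁻¹) * a)) • x := by
    have h := mul_of_quad' (t := t) (H.quad k hk) (L := JM k) rfl
    have h2 : T k * (JM (k + 1) * x) = JM k * (T k * x) + (t - t⁻¹) • (JM (k + 1) * x) := by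
      rw [← mul_assoc, ← mul_assoc, ← smul_mul_assoc, ← add_mul]
      exact congrArg (· * x) h
    rw [hb, mul_smul_comm, smul_smul] at h2
    rw [map_sub, aeval_X, aeval_C, sub_mul, ← Algebra.smul_def, h2, neg_smul]
    abel
  have h2 := hp _ (H.inv_T_mul hk hx')
  rw [jmPoly, mul_comm, map_mul, mul_assoc, h1, mul_smul_comm] at h2
  have h3 := (smul_eq_zero.1 h2).resolve_left (neg_ne_zero.2 (mul_ne_zero G.h_ne ha0))
  exact eq_zero_of_aeval_mul hLx h3 (G.cofactor_eval k k (by omega))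

/-- The intertwiner kills `x`, which gives `T_{k+1} x = -t⁻¹ x`, while invariance gives `T_k x = t
x`. The braid relation on `x` then reads `-t = t⁻¹`, so `t² = -1` unless `x = 0`. -/
theorem eq_zero_of_jm_eq (H : HeckeRelations N t v F T U) (G : HeckeGeneric N t v F) {k : ℕ}
    (hk : k + 1 < N) (hp : ∀ x, Inv (k + 1) x → aeval (JM (k + 1)) (jmPoly t v F (k + 1)) * x = 0)
    {x : A} (hx : Inv (k + 2) x) (hb : JM (k + 2) * x = (v * t ^ (2 * k)) • x) : x = 0 := by
  have ht := G.t_ne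
  have hLx : JM (k + 1) * x = (v * t ^ (2 * (k + 1))) • x := hx.jm_mul_eq _ (by omega)
  have hx' := hx.mono (Nat.le_succ (k + 1))
  have ha0 : v * t ^ (2 * k) ≠ 0 := mul_ne_zero G.v_ne (pow_ne_zero _ ht)
  have h1 : t ^ 2 - 1 ≠ 0 := sub_ne_zero.2 G.t_sq
  have hz := H.intertwiner_eq_zero hk hp hx' hLx hb (by
    rw [eval_jmPoly]
    refine mul_ne_zero ?_ (G.cofactor_eval _ _ (by omega))
    have : v * t ^ (2 * k) - v * t ^ (2 * (k + 1)) = -(v * t ^ (2 * k) * (t ^ 2 - 1)) := by ring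
    rw [this]
    exact neg_ne_zero.2 (mul_ne_zero ha0 h1))
  have hT : T (k + 1) * x = (-t⁻¹) • x := by
    have e1 : v * t ^ (2 * (k + 1)) - v * t ^ (2 * k) = v * t ^ (2 * k) * (t ^ 2 - 1) := by ring
    have e2 : (t - t⁻¹) * (v * t ^ (2 * k)) = v * t ^ (2 * k) * (t ^ 2 - 1) * t⁻¹ := by
      field_simp
    rw [e1, e2, mul_smul _ t⁻¹, ← smul_add] at hz
    have := (smul_eq_zero.1 hz).resolve_left (mul_ne_zero ha0 h1)
    rw [neg_smul]
    exact eq_neg_of_add_eq_zero_left this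
  have hT' : T k * x = t • x := hx.2 k (by omega)
  have hbr := congrArg (· * x) (H.braid k hk)
  simp only [mul_assoc, hT, hT', mul_smul_comm, smul_smul] at hbr
  rw [← sub_eq_zero, ← sub_smul] at hbr
  refine (smul_eq_zero.1 hbr).resolve_left fun e => G.t_sq' ?_
  field_simp at e
  linear_combination -e

/-- The polynomial of degree `deg p_k + 2` obtained from the square of the intertwiner. -/
theorem aeval_jm_succ (H : HeckeRelations N t v F T U) (G : HeckeGeneric N t v F) {k : ℕ}
    (hk : k < N) (hp : ∀ x, Inv k x → aeval (JM k) (jmPoly t v F k) * x = 0) {x : A}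
    (hx : Inv (k + 1) x) :
    aeval (JM (k + 1)) ((X - C (v * t ^ (2 * (k + 1)))) * (X - C (v * t ^ (2 * k) * (t ^ 2)⁻¹)) *
      jmPoly t v F k) * x = 0 := by
  have ht := G.t_ne
  have hc := (H.jm_commute_jm (k + 1) k (by omega) hk).symm.eq
  have hx' := hx.mono (Nat.le_succ k)
  set a := v * t ^ (2 * k) with ha
  set τ := intertwiner t (JM k) (JM (k + 1)) (T k) with hτ
  set y := aeval (JM (k + 1)) (jmPoly t v F k) * x with hy
  have hiτ : Inv k (τ * x) := by
    have e : τ * x = a • (T k * x) + (1 : ℂ) • ((-(T k)) * (JM (k + 1) * x) +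
        (t - t⁻¹) • (JM (k + 1) * x)) := by
      rw [hτ, intertwiner, add_mul, mul_assoc, sub_mul, hx.jm_mul_eq k (by omega), mul_sub,
        mul_smul_comm, smul_mul_assoc, one_smul, neg_mul, ← ha]
      abel
    have hj : Inv k (JM (k + 1) * x) := by
      have := hx'.mul_left (y := JM (k + 1)) (fun _ => H.jm_commute_U _ hk)
        fun i hi => H.jm_commute_T_of_gt _ _ (by omega) hk
      exact this
    rw [e]
    refine (H.inv_T_mul hk hx').smul_add_smul ?_
    have := (H.inv_T_mul hk hj).smul_add_smul hj (a := -1) (b := t - t⁻¹)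
    simpa using this
  -- Moving `τ` through the polynomial turns `p_k(L_{k+1})` into `p_k(L_k)`, which kills the
  -- invariant `τ x`.
  have hyτ : τ * y = 0 := by
    rw [hy, ← mul_assoc,
      aeval_semiconj (intertwiner_mul_right (H.quad k hk) (jucysMurphy_succ T U k) hc), mul_assoc]
    exact hp _ hiτ
  -- Since `L_k` acts on `y` by `a`, the equation `τ² y = 0` becomes a quadratic polynomial in
  -- `L_{k+1}` alone.
  have hLy : JM k * y = a • y := by
    rw [hy, ← mul_assoc, aeval_semiconj hc, mul_assoc, hx.jm_mul_eq k (by omega), mul_smul_comm]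
  have h2 : τ * τ * y = 0 := by rw [mul_assoc, hyτ, mul_zero]
  rw [hτ, intertwiner_sq ht (H.quad k hk) (jucysMurphy_succ T U k) hc, neg_mul, neg_eq_zero] at h2
  rw [map_mul, mul_assoc, ← hy, ← h2]
  have e1 : v * t ^ (2 * (k + 1)) = a * t ^ 2 := by rw [ha]; ring
  rw [e1, map_mul, map_sub, map_sub, aeval_X, aeval_C, aeval_C]
  simp only [add_mul, sub_mul, mul_sub, mul_assoc, smul_mul_assoc]
  simp only [← Algebra.smul_def, ← mul_assoc]
  simp only [mul_assoc, hLy, hc, mul_smul_comm, smul_smul]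
  have e2 : a * (t ^ 2 * (a * (t ^ 2)⁻¹)) = a * a := by field_simp
  rw [e2, smul_mul_assoc]
  module

/-- `p(L_k) x` is again invariant and is an eigenvector for `r`, hence zero when `r` is not an
eigenvalue on invariants. -/
theorem remove_root (H : HeckeRelations N t v F T U) {k : ℕ} (hk : k ≤ N) {r : ℂ} {p : ℂ[X]}
    (hr : ∀ x, Inv k x → JM k * x = r • x → x = 0)
    (hp : ∀ x, Inv k x → aeval (JM k) ((X - C r) * p) * x = 0) (x : A) (hx : Inv k x) :
    aeval (JM k) p * x = 0 := by
  refine hr _ (H.inv_aeval_jm_mul hk hx p) ?_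
  have h := hp x hx
  rw [map_mul, mul_assoc, map_sub, aeval_X, aeval_C, sub_mul, ← Algebra.smul_def] at h
  exact sub_eq_zero.1 h

/-- The square of the intertwiner passes from `p_k` to `p_k (X - v t^{2k+2}) (X - v t^{2k-2})`. The
root `v t^{2k}` of `p_k` is then discarded by `eq_zero_of_jm_eq_jm`. For `k ≥ 1` the root `v
t^{2k-2}` is discarded by `eq_zero_of_jm_eq`, so the degree stays constant from level one on. -/
theorem aeval_jm (H : HeckeRelations N t v F T U) (G : HeckeGeneric N t v F) (k : ℕ) (hk : k ≤ N)
    (x : A) (hx : Inv k x) : aeval (JM k) (jmPoly t v F k) * x = 0 := by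
  induction k generalizing x with
  | zero =>
    have : jmPoly t v F 0 = (X - C v) * F := by simp [jmPoly, jmCofactor]
    rw [this, jucysMurphy, H.poly, zero_mul]
  | succ k ih =>
    have ih := ih (by omega)
    have h1 : ∀ x, Inv (k + 1) x → aeval (JM (k + 1)) ((X - C (v * t ^ (2 * (k + 1)))) *
        (X - C (v * t ^ (2 * k) * (t ^ 2)⁻¹)) * jmCofactor t v F k) * x = 0 :=
      H.remove_root hk (fun x hx hb => H.eq_zero_of_jm_eq_jm G hk ih hx hb) fun x hx => by
        have := H.aeval_jm_succ G hk ih hx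
        rwa [jmPoly, mul_left_comm] at this
    -- For `k = 0` the root `v t^{2k-2}` is `v t⁻²`, which persists in every later polynomial.
    rcases k with _ | k
    · have := h1 x hx
      simpa [jmPoly, jmCofactor, mul_assoc] using this
    · have e : v * t ^ (2 * (k + 1)) * (t ^ 2)⁻¹ = v * t ^ (2 * k) := by
        have := G.t_ne
        rw [mul_add, pow_add]
        field_simp
      rw [e] at h1
      have := H.remove_root hk (p := jmPoly t v F (k + 2))
        (fun x hx hb => H.eq_zero_of_jm_eq G hk ih hx hb) (fun x hx => by
          have := h1 x hx
          rw [jmPoly, mul_left_comm, ← mul_assoc]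
          exact this) x hx
      exact this

/-- The eigenvectors of top eigenvalue are invariant under one more generator. -/
theorem inv_succ_of_jm_eq (H : HeckeRelations N t v F T U) (G : HeckeGeneric N t v F) {k : ℕ}
    (hk : k ≤ N) {x : A} (hx : Inv k x) (h : JM k * x = (v * t ^ (2 * k)) • x) :
    Inv (k + 1) x := by
  rcases k with _ | k
  · exact ⟨fun _ => by simpa [jucysMurphy] using h, fun i hi => by omega⟩
  refine ⟨fun _ => hx.1 (by omega), fun i hi => ?_⟩
  rcases Nat.lt_or_ge (i + 1) (k + 1) with hi' | hi'
  · exact hx.2 i hi'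
  obtain rfl : i = k := by omega
  have ht := G.t_ne
  have hLx : JM i * x = (v * t ^ (2 * i)) • x := hx.jm_mul_eq _ (by omega)
  have ha0 : v * t ^ (2 * i) ≠ 0 := mul_ne_zero G.v_ne (pow_ne_zero _ ht)
  have h1 : 1 - t ^ 2 ≠ 0 := sub_ne_zero.2 (Ne.symm G.t_sq)
  -- The top eigenvalue `v t^{2(i+1)}` is not a root of `p_i`, so the intertwiner vanishes on `x`;
  -- its formula then simplifies to `T_i x = t x`.
  have hz := H.intertwiner_eq_zero hk (H.aeval_jm G i (by omega)) (hx.mono (Nat.le_succ i)) hLx h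
    (by
      rw [eval_jmPoly]
      refine mul_ne_zero ?_ (G.cofactor_eval _ _ (by omega))
      have : v * t ^ (2 * (i + 1)) - v * t ^ (2 * i) = -(v * t ^ (2 * i) * (1 - t ^ 2)) := by ring
      rw [this]
      exact neg_ne_zero.2 (mul_ne_zero ha0 h1))
  have e1 : v * t ^ (2 * i) - v * t ^ (2 * (i + 1)) = v * t ^ (2 * i) * (1 - t ^ 2) := by ring
  have e2 : (t - t⁻¹) * (v * t ^ (2 * (i + 1))) = -(v * t ^ (2 * i) * (1 - t ^ 2) * t) := by
    field_simp; ring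
  rw [e1, e2, neg_smul, mul_smul _ t, ← sub_eq_add_neg, ← smul_sub] at hz
  exact sub_eq_zero.1 ((smul_eq_zero.1 hz).resolve_left (mul_ne_zero ha0 h1))

/-- There is an invariant element on which the character `χ` does not vanish, and on which all
right invariants act by a nonzero scalar. -/
theorem exists_inv (H : HeckeRelations N t v F T U) (G : HeckeGeneric N t v F) (k : ℕ)
    (hk : k ≤ N) : ∃ (e : A) (γ : ℂ), γ ≠ 0 ∧ Inv k e ∧
      (∀ y : A, (0 < k → y * U = v • y) → (∀ i, i + 1 < k → y * T i = t • y) → y * e = γ • y) ∧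
      ∀ χ : A →ₐ[ℂ] ℂ, χ U = v → (∀ i < N, χ (T i) = t) → χ e = γ := by
  induction k with
  | zero => exact ⟨1, 1, one_ne_zero, ⟨by simp, by simp⟩, by simp, by simp⟩
  | succ k ih =>
    obtain ⟨e, γ, hγ, he, hr, hχ⟩ := ih (by omega)
    have hk' : k ≤ N := by omega
    -- Applying the cofactor of `X - v t^{2k}` projects, up to a nonzero scalar, to the top
    -- eigenspace of `L_k`, which consists of invariants of the next level. The scalar is the value
    -- of the cofactor at the top eigenvalue.
    refine ⟨aeval (JM k) (jmCofactor t v F k) * e,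
      (jmCofactor t v F k).eval (v * t ^ (2 * k)) * γ,
      mul_ne_zero (G.cofactor_eval k k (by omega)) hγ, ?_, ?_, ?_⟩
    · refine H.inv_succ_of_jm_eq G hk' (H.inv_aeval_jm_mul hk' he _) ?_
      have h := H.aeval_jm G k hk' e he
      rw [jmPoly, map_mul, mul_assoc, map_sub, aeval_X, aeval_C, sub_mul, ← Algebra.smul_def] at h
      exact sub_eq_zero.1 h
    · intro y hU hT
      have hj : ∀ i ≤ k, y * JM i = (v * t ^ (2 * i)) • y := by
        intro i hi
        induction i with
        | zero => simpa [jucysMurphy] using hU (by omega)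
        | succ i ih =>
          rw [jucysMurphy, ← mul_assoc, ← mul_assoc, hT i (by omega), smul_mul_assoc,
            ih (by omega), smul_smul, smul_mul_assoc, hT i (by omega), smul_smul]
          congr 1; ring
      have hp : ∀ p : ℂ[X], y * aeval (JM k) p = p.eval (v * t ^ (2 * k)) • y := by
        intro p
        have hpow : ∀ j, y * JM k ^ j = (v * t ^ (2 * k)) ^ j • y := by
          intro j
          induction j with
          | zero => simp
          | succ j ih => rw [pow_succ, ← mul_assoc, ih, smul_mul_assoc, hj k le_rfl, smul_smul,
              pow_succ]
        induction p using Polynomial.induction_on' with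
        | add p q hp hq => rw [map_add, mul_add, hp, hq, eval_add, add_smul]
        | monomial j c =>
          rw [aeval_monomial, eval_monomial, ← mul_assoc, ← Algebra.commutes, mul_assoc, hpow,
            ← Algebra.smul_def, smul_smul]
      rw [← mul_assoc, hp, smul_mul_assoc, hr y (fun _ => hU (by omega))
        (fun i hi => hT i (by omega)), smul_smul]
    · intro χ hU hT
      have hj : ∀ i ≤ N, χ (JM i) = v * t ^ (2 * i) := by
        intro i hi
        induction i with
        | zero => simpa [jucysMurphy] using hU
        | succ i ih =>
          rw [jucysMurphy, map_mul, map_mul, hT i (by omega), ih (by omega)]; ring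
      rw [map_mul, ← Polynomial.aeval_algHom_apply, hj k hk', hχ χ hU hT,
        ← Polynomial.coe_aeval_eq_eval]

end HeckeRelations

/-! ### The left ideal generated by an invariant, and a dimension bound -/

/-- `T_j T_{j+1} ⋯ T_{N-1}`. -/
def icoProd {A : Type*} [Monoid A] (T : ℕ → A) (N j : ℕ) : A := ((List.Ico j N).map T).prod

theorem icoProd_self {A : Type*} [Monoid A] (T : ℕ → A) (N : ℕ) : icoProd T N N = 1 := by
  simp [icoProd]

theorem icoProd_of_lt {A : Type*} [Monoid A] (T : ℕ → A) {N j : ℕ} (h : j < N) :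
    icoProd T N j = T j * icoProd T N (j + 1) := by
  rw [icoProd, List.Ico.eq_cons h, List.map_cons, List.prod_cons, icoProd]

theorem commute_icoProd {A : Type*} [Monoid A] {T : ℕ → A} {N j : ℕ} {x : A}
    (h : ∀ i, j ≤ i → i < N → Commute x (T i)) : Commute x (icoProd T N j) :=
  Commute.list_prod_right _ _ fun y hy => by
    obtain ⟨i, hi, rfl⟩ := List.mem_map.1 hy
    rw [List.Ico.mem] at hi
    exact h i hi.1 hi.2

namespace HeckeRelations

variable {A : Type*} [Ring A] [Algebra ℂ A] {N : ℕ} {t v : ℂ} {F : ℂ[X]} {T : ℕ → A} {U : A}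

local notation "JM" => jucysMurphy T U
local notation "Inv" => IsHeckeInvariant t v T U

/-- The induction runs over the length `d` of the word, which grows at its left end; the braid
relation is needed only when `i = j`. -/
theorem T_mul_icoProd (H : HeckeRelations N t v F T U) (d : ℕ) :
    ∀ j, j + d = N → ∀ i, j ≤ i → i + 1 < N →
      T (i + 1) * icoProd T N j = icoProd T N j * T i := by
  induction d with
  | zero => intro j hj i hi hN; omega
  | succ d ih =>
    intro j hj i hi hN
    rw [icoProd_of_lt T (show j < N by omega)]
    rcases Nat.lt_or_ge j i with h | h
    · rw [← mul_assoc, ← H.comm j (i + 1) (by omega) hN, mul_assoc, ih (j + 1) (by omega) i h hN,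
        mul_assoc]
    · obtain rfl : i = j := by omega
      have hc : Commute (T i) (icoProd T N (i + 2)) :=
        commute_icoProd fun k hk hkN => H.comm i k (by omega) hkN
      rw [icoProd_of_lt T hN]
      have hb := H.braid i hN
      calc T (i + 1) * (T i * (T (i + 1) * icoProd T N (i + 2)))
          = T (i + 1) * T i * T (i + 1) * icoProd T N (i + 2) := by simp only [mul_assoc]
        _ = T i * T (i + 1) * (T i * icoProd T N (i + 2)) := by rw [← hb, mul_assoc]
        _ = _ := by rw [hc.eq]; simp only [mul_assoc]

/-- The span of the elements `T_j ⋯ T_{N-1} p(L_N) e`. -/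
def inducedSpan (N : ℕ) (T : ℕ → A) (U e : A) : Submodule ℂ A :=
  Submodule.span ℂ {z | ∃ j ≤ N, ∃ p : ℂ[X], z = icoProd T N j * (aeval (jucysMurphy T U N) p * e)}

theorem mem_inducedSpan {e : A} {j : ℕ} (hj : j ≤ N) (p : ℂ[X]) :
    icoProd T N j * (aeval (JM N) p * e) ∈ inducedSpan N T U e :=
  Submodule.subset_span ⟨j, hj, p, rfl⟩

/-- If `i + 1 < j`, `T_i` passes through the word and acts by `t`; if `i + 1 = j`, it lengthens the
word; if `i = j`, the quadratic relation applies; if `i > j`, it emerges on the right as `T_{i-1}`,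
which acts by `t`. -/
theorem T_mul_mem_inducedSpan (H : HeckeRelations N t v F T U) {e : A} (he : Inv N e) {i : ℕ}
    (hi : i < N) {z : A} (hz : z ∈ inducedSpan N T U e) : T i * z ∈ inducedSpan N T U e := by
  induction hz using Submodule.span_induction with
  | zero => rw [mul_zero]; exact Submodule.zero_mem _
  | add x y _ _ hx hy => rw [mul_add]; exact Submodule.add_mem _ hx hy
  | smul c x _ hx => rw [mul_smul_comm]; exact Submodule.smul_mem _ c hx
  | mem x hx =>
    obtain ⟨j, hj, p, rfl⟩ := hx
    have hy := H.inv_aeval_jm_mul le_rfl he p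
    rcases Nat.lt_trichotomy i j with h | rfl | h
    · rcases Nat.lt_or_ge (i + 1) j with h' | h'
      · have hc : Commute (T i) (icoProd T N j) :=
          commute_icoProd fun k hk hkN => H.comm i k (by omega) hkN
        rw [← mul_assoc, hc.eq, mul_assoc, hy.2 i (by omega), mul_smul_comm]
        exact Submodule.smul_mem _ _ (mem_inducedSpan hj p)
      · obtain rfl : j = i + 1 := by omega
        rw [← mul_assoc, ← icoProd_of_lt T hi]
        exact mem_inducedSpan hi.le p
    · rw [icoProd_of_lt T hi, ← mul_assoc, ← mul_assoc, ← mul_assoc, H.quad i hi, add_mul, one_mul,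
        smul_mul_assoc, ← icoProd_of_lt T hi, add_mul, add_mul, smul_mul_assoc, smul_mul_assoc,
        mul_assoc, mul_assoc]
      exact Submodule.add_mem _ (Submodule.smul_mem _ _ (mem_inducedSpan hj p))
        (mem_inducedSpan hi p)
    · obtain ⟨i, rfl⟩ : ∃ i', i = i' + 1 := ⟨i - 1, by omega⟩
      rw [← mul_assoc, H.T_mul_icoProd (N - j) j (by omega) i (by omega) hi, mul_assoc,
        hy.2 i hi, mul_smul_comm]
      exact Submodule.smul_mem _ _ (mem_inducedSpan hj p)

/-- Descending induction on `j`. With `y` the element in question, `T_j y` is the corresponding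
element for `j + 1`. Multiplying by `T_j` once more and using the quadratic relation recovers `y`,
so no inverse of `T_j` is needed. -/
theorem jm_mul_mem_inducedSpan (H : HeckeRelations N t v F T U) {e : A} (he : Inv N e) (p : ℂ[X])
    (d : ℕ) : ∀ j, j + d = N →
      JM j * (icoProd T N j * (aeval (JM N) p * e)) ∈ inducedSpan N T U e := by
  induction d with
  | zero =>
    intro j hj
    obtain rfl : j = N := hj
    have := mem_inducedSpan (T := T) (U := U) (e := e) (N := j) (le_refl j) (X * p)
    rw [icoProd_self, one_mul] at this ⊢
    rwa [map_mul, aeval_X, mul_assoc] at this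
  | succ d ih =>
    intro j hj
    have h1 := ih (j + 1) (by omega)
    have hjN : j < N := by omega
    set y := JM j * (icoProd T N j * (aeval (JM N) p * e)) with hy
    have e1 : JM (j + 1) * (icoProd T N (j + 1) * (aeval (JM N) p * e)) = T j * y := by
      rw [hy, jucysMurphy_succ, icoProd_of_lt T hjN]; simp only [mul_assoc]
    rw [e1] at h1
    have h2 := H.T_mul_mem_inducedSpan he hjN h1
    rw [← mul_assoc, H.quad j hjN, add_mul, one_mul, smul_mul_assoc] at h2
    exact (Submodule.add_mem_iff_right _ (Submodule.smul_mem _ _ h1)).1 h2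

theorem U_mul_mem_inducedSpan (H : HeckeRelations N t v F T U) {e : A} (he : Inv N e)
    {z : A} (hz : z ∈ inducedSpan N T U e) : U * z ∈ inducedSpan N T U e := by
  induction hz using Submodule.span_induction with
  | zero => rw [mul_zero]; exact Submodule.zero_mem _
  | add x y _ _ hx hy => rw [mul_add]; exact Submodule.add_mem _ hx hy
  | smul c x _ hx => rw [mul_smul_comm]; exact Submodule.smul_mem _ c hx
  | mem x hx =>
    obtain ⟨j, hj, p, rfl⟩ := hx
    rcases Nat.eq_zero_or_pos j with rfl | h
    · exact H.jm_mul_mem_inducedSpan he p N 0 (by omega)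
    · have hc : Commute U (icoProd T N j) :=
        commute_icoProd fun k hk hkN => H.comm_U k (by omega) hkN
      have hy := H.inv_aeval_jm_mul le_rfl he p
      rw [← mul_assoc, hc.eq, mul_assoc, hy.1 (by omega), mul_smul_comm]
      exact Submodule.smul_mem _ _ (mem_inducedSpan hj p)

theorem mul_mem_inducedSpan (H : HeckeRelations N t v F T U) {e : A} (he : Inv N e) {a : A}
    (ha : a ∈ Algebra.adjoin ℂ ({U} ∪ T '' Set.Iio N)) :
    a * e ∈ inducedSpan N T U e := by
  have key : ∀ z ∈ inducedSpan N T U e, a * z ∈ inducedSpan N T U e := by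
    induction ha using Algebra.adjoin_induction with
    | mem x hx =>
      intro z hz
      rcases hx with rfl | ⟨i, hi, rfl⟩
      · exact H.U_mul_mem_inducedSpan he hz
      · exact H.T_mul_mem_inducedSpan he hi hz
    | algebraMap c => intro z hz; rw [← Algebra.smul_def]; exact Submodule.smul_mem _ _ hz
    | add x y _ _ hx hy => intro z hz; rw [add_mul]; exact Submodule.add_mem _ (hx z hz) (hy z hz)
    | mul x y _ _ hx hy => intro z hz; rw [mul_assoc]; exact hx _ (hy z hz)
  refine key e ?_
  have := mem_inducedSpan (T := T) (U := U) (e := e) (le_refl N) 1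
  simpa [icoProd_self] using this

theorem inducedSpan_le {e : A} {q : ℂ[X]} (hq : q.Monic) (h : aeval (JM N) q * e = 0) :
    inducedSpan N T U e ≤ Submodule.span ℂ (Set.range
      fun x : Fin (N + 1) × Fin q.natDegree => icoProd T N x.1 * (JM N ^ (x.2 : ℕ) * e)) := by
  refine Submodule.span_le.2 ?_
  rintro _ ⟨j, hj, p, rfl⟩
  have h1 : aeval (JM N) p * e = aeval (JM N) (p %ₘ q) * e := by
    conv_lhs => rw [← modByMonic_add_div p q, map_add, add_mul, mul_comm q, map_mul, mul_assoc, h,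
      mul_zero, add_zero]
  rw [h1]
  -- The degree bound for the remainder excludes `q = 1`, where the remainder is zero.
  rcases eq_or_ne q 1 with rfl | hq1
  · simp
  rw [aeval_eq_sum_range' (natDegree_modByMonic_lt p hq hq1), Finset.sum_mul, Finset.mul_sum]
  refine Submodule.sum_mem _ fun i hi => ?_
  rw [smul_mul_assoc, mul_smul_comm]
  exact Submodule.smul_mem _ _
    (Submodule.subset_span ⟨(⟨j, by omega⟩, ⟨i, Finset.mem_range.1 hi⟩), rfl⟩)

/-- The space of invariants of left multiplication. -/
def invariants (t v : ℂ) (T : ℕ → A) (U : A) (k : ℕ) : Submodule ℂ A where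
  carrier := {x | IsHeckeInvariant t v T U k x}
  zero_mem' := ⟨by simp, by simp⟩
  add_mem' hx hy := by simpa using hx.smul_add_smul hy (a := 1) (b := 1)
  smul_mem' c x hx := by simpa using IsHeckeInvariant.smul_add_smul hx hx (a := c) (b := 0)

/-- In the opposite algebra, take the invariant `e` of `exists_inv`. A left invariant `x` satisfies
`x e = γ x` there with `γ ≠ 0`, so `x` lies in the left ideal generated by `e`. That ideal is
spanned by `N + 1` words times the powers of the last Jucys–Murphy element below `deg p_N`. -/
theorem invariants_finite (H : HeckeRelations N t v F T U) (G : HeckeGeneric N t v F)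
    (hF : F.Monic) (hA : Algebra.adjoin ℂ ({U} ∪ T '' Set.Iio N) = ⊤) :
    FiniteDimensional ℂ (invariants t v T U N) ∧
      Module.finrank ℂ (invariants t v T U N) ≤ (N + 1) * (F.natDegree + 2) := by
  obtain ⟨e, γ, hγ, he, hr, -⟩ := H.op.exists_inv G N le_rfl
  have hmon : (jmPoly t v F N).Monic := by
    cases N with
    | zero => exact (monic_X_sub_C _).mul hF
    | succ N => exact (monic_X_sub_C _).mul ((monic_X_sub_C _).mul hF)
  have hdeg : (jmPoly t v F N).natDegree ≤ F.natDegree + 2 := by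
    cases N with
    | zero =>
      rw [jmPoly, jmCofactor, (monic_X_sub_C _).natDegree_mul hF, natDegree_X_sub_C]; omega
    | succ N =>
      rw [jmPoly, jmCofactor, (monic_X_sub_C _).natDegree_mul ((monic_X_sub_C _).mul hF),
        (monic_X_sub_C _).natDegree_mul hF, natDegree_X_sub_C, natDegree_X_sub_C]; omega
  have hop (a : A) : MulOpposite.op a ∈ Algebra.adjoin ℂ
      ({MulOpposite.op U} ∪ (fun i => MulOpposite.op (T i)) '' Set.Iio N) := by
    have ha : a ∈ Algebra.adjoin ℂ ({U} ∪ T '' Set.Iio N) := hA ▸ Algebra.mem_top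
    induction ha using Algebra.adjoin_induction with
    | mem x hx =>
      refine Algebra.subset_adjoin ?_
      rcases hx with rfl | ⟨i, hi, rfl⟩
      · exact Or.inl rfl
      · exact Or.inr ⟨i, hi, rfl⟩
    | algebraMap c => rw [← MulOpposite.algebraMap_apply]; exact Subalgebra.algebraMap_mem _ c
    | add x y _ _ hx hy => rw [MulOpposite.op_add]; exact add_mem hx hy
    | mul x y _ _ hx hy => rw [MulOpposite.op_mul]; exact mul_mem hy hx
  have hle := inducedSpan_le (N := N) hmon (H.op.aeval_jm G N le_rfl e he)
  set f : Fin (N + 1) × Fin (jmPoly t v F N).natDegree → Aᵐᵒᵖ := _ with hf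
  change inducedSpan N (fun i => MulOpposite.op (T i)) (MulOpposite.op U) e ≤
    Submodule.span ℂ (Set.range f) at hle
  let φ : invariants t v T U N →ₗ[ℂ] Aᵐᵒᵖ :=
    (MulOpposite.opLinearEquiv ℂ).toLinearMap ∘ₗ (invariants t v T U N).subtype
  have hφi : Function.Injective φ := fun x y h =>
    Subtype.ext (MulOpposite.op_injective h)
  have hφ : ∀ x, φ x ∈ Submodule.span ℂ (Set.range f) := by
    intro x
    have hx : IsHeckeInvariant t v T U N x.1 := x.2
    have h1 := hr (MulOpposite.op x.1) (fun h => by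
      rw [← MulOpposite.op_mul, hx.1 h, MulOpposite.op_smul]) (fun i hi => by
      rw [← MulOpposite.op_mul, hx.2 i hi, MulOpposite.op_smul])
    have h2 : φ x = γ⁻¹ • (MulOpposite.op x.1 * e) := by
      rw [h1, smul_smul, inv_mul_cancel₀ hγ, one_smul]; rfl
    rw [h2]
    exact Submodule.smul_mem _ _ (hle (H.op.mul_mem_inducedSpan he (hop x.1)))
  let ψ : invariants t v T U N →ₗ[ℂ] Submodule.span ℂ (Set.range f) := φ.codRestrict _ hφ
  have hψ : Function.Injective ψ := fun x y h => hφi (congrArg Subtype.val h)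
  have : FiniteDimensional ℂ (Submodule.span ℂ (Set.range f)) :=
    FiniteDimensional.span_of_finite ℂ (Set.finite_range f)
  refine ⟨FiniteDimensional.of_injective ψ hψ, ?_⟩
  refine (LinearMap.finrank_le_finrank_of_injective hψ).trans
    ((finrank_range_le_card f).trans ?_)
  rw [Fintype.card_prod, Fintype.card_fin, Fintype.card_fin]
  exact Nat.mul_le_mul_left _ hdeg

end HeckeRelations

/-! ## Diagonalizable operators -/

/-- Distinct linear factors are coprime, so the kernel of the product is the sum of the kernels of
the factors. -/
theorem iSup_eigenspace_eq_top_of_aeval_eq_zero {V : Type*} [AddCommGroup V] [Module ℂ V]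
    (f : Module.End ℂ V) {ι : Type*} [Fintype ι] (w : ι → ℂ) (hw : Function.Injective w)
    (hf : aeval f (∏ i, (X - C (w i))) = 0) : ⨆ i, f.eigenspace (w i) = ⊤ := by
  classical
  have key : ∀ s : Finset ι, LinearMap.ker (aeval f (∏ i ∈ s, (X - C (w i)))) ≤
      ⨆ i, f.eigenspace (w i) := by
    intro s
    induction s using Finset.induction_on with
    | empty => rw [Finset.prod_empty, map_one]; exact fun x hx => by simp_all
    | insert a s ha ih =>
      rw [Finset.prod_insert ha, ← sup_ker_aeval_eq_ker_aeval_mul_of_coprime]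
      · refine sup_le (le_trans (fun x hx => ?_) (le_iSup _ a)) ih
        rw [LinearMap.mem_ker, map_sub, aeval_X, aeval_C, LinearMap.sub_apply,
          Module.algebraMap_end_apply, sub_eq_zero] at hx
        exact Module.End.mem_eigenspace_iff.2 hx
      · refine IsCoprime.prod_right fun i hi => ?_
        refine isCoprime_X_sub_C_of_isUnit_sub (sub_ne_zero.2 fun h => ha ?_).isUnit
        rwa [hw h]
  refine top_unique (le_trans ?_ (key Finset.univ))
  rw [hf, LinearMap.ker_zero]

theorem exists_eigenbasis {V : Type*} [AddCommGroup V] [Module ℂ V] [FiniteDimensional ℂ V]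
    (f : Module.End ℂ V) {ι : Type*} [Fintype ι] [DecidableEq ι] (w : ι → ℂ)
    (hw : Function.Injective w) (hf : aeval f (∏ i, (X - C (w i))) = 0) :
    ∃ b : Module.Basis (Σ i, Fin (Module.finrank ℂ (f.eigenspace (w i)))) ℂ V,
      ∀ s, f (b s) = w s.1 • b s := by
  have hint := DirectSum.isInternal_submodule_of_iSupIndep_of_iSup_eq_top
    (f.eigenspaces_iSupIndep.comp hw) (iSup_eigenspace_eq_top_of_aeval_eq_zero f w hw hf)
  refine ⟨hint.collectedBasis fun i => Module.finBasis ℂ _, fun s => ?_⟩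
  exact Module.End.mem_eigenspace_iff.1 (hint.collectedBasis_mem _ s)

theorem toMatrix_eigenbasis {V : Type*} [AddCommGroup V] [Module ℂ V] {J : Type*} [Fintype J]
    [DecidableEq J] (f : Module.End ℂ V) (b : Module.Basis J ℂ V) (w : J → ℂ)
    (h : ∀ s, f (b s) = w s • b s) : LinearMap.toMatrix b b f = Matrix.diagonal w := by
  ext i j
  rw [LinearMap.toMatrix_apply, h, map_smul, Module.Basis.repr_self, Matrix.diagonal_apply]
  by_cases hij : i = j
  · subst hij; simp
  · simp [hij]

theorem sum_finrank_eigenspace {V : Type*} [AddCommGroup V] [Module ℂ V] [FiniteDimensional ℂ V]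
    (f : Module.End ℂ V) {ι : Type*} [Fintype ι] (w : ι → ℂ)
    (hw : Function.Injective w) (hf : aeval f (∏ i, (X - C (w i))) = 0) :
    ∑ i, Module.finrank ℂ (f.eigenspace (w i)) = Module.finrank ℂ V := by
  classical
  obtain ⟨b, -⟩ := exists_eigenbasis f w hw hf
  rw [Module.finrank_eq_card_basis b]
  simp

theorem det_eq_prod_eigenvalues {V : Type*} [AddCommGroup V] [Module ℂ V]
    [FiniteDimensional ℂ V] (f : Module.End ℂ V) {ι : Type*} [Fintype ι] (w : ι → ℂ)
    (hw : Function.Injective w) (hf : aeval f (∏ i, (X - C (w i))) = 0) :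
    LinearMap.det f = ∏ i, w i ^ Module.finrank ℂ (f.eigenspace (w i)) := by
  classical
  obtain ⟨b, hb⟩ := exists_eigenbasis f w hw hf
  rw [← LinearMap.det_toMatrix b, toMatrix_eigenbasis f b (fun s => w s.1) hb,
    Matrix.det_diagonal, Fintype.prod_sigma]
  simp

theorem trace_eq_sum_eigenvalues {V : Type*} [AddCommGroup V] [Module ℂ V]
    [FiniteDimensional ℂ V] (f : Module.End ℂ V) {ι : Type*} [Fintype ι] (w : ι → ℂ)
    (hw : Function.Injective w) (hf : aeval f (∏ i, (X - C (w i))) = 0) :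
    LinearMap.trace ℂ V f = ∑ i, Module.finrank ℂ (f.eigenspace (w i)) * w i := by
  classical
  obtain ⟨b, hb⟩ := exists_eigenbasis f w hw hf
  rw [LinearMap.trace_eq_matrix_trace ℂ b, toMatrix_eigenbasis f b (fun s => w s.1) hb,
    Matrix.trace_diagonal, Fintype.sum_sigma]
  simp

/-! ## Similar matrices -/

namespace SimilarMatrices

variable {I J K : Type*} [Fintype I] [Fintype J] [Fintype K] [DecidableEq I] [DecidableEq J]
  [DecidableEq K] {X : Matrix I I ℂ} {Y : Matrix J J ℂ} {Z : Matrix K K ℂ}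

theorem symm (h : SimilarMatrices X Y) : SimilarMatrices Y X := by
  obtain ⟨P, Q, h1, h2, rfl⟩ := h
  refine ⟨Q, P, h2, h1, ?_⟩
  calc Y = (Q * P) * Y * (Q * P) := by rw [h2, Matrix.one_mul, Matrix.mul_one]
    _ = _ := by simp only [Matrix.mul_assoc]

theorem trans (h : SimilarMatrices X Y) (h' : SimilarMatrices Y Z) : SimilarMatrices X Z := by
  obtain ⟨P, Q, h1, h2, rfl⟩ := h
  obtain ⟨P', Q', h1', h2', rfl⟩ := h'
  refine ⟨P * P', Q' * Q, ?_, ?_, ?_⟩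
  · calc P * P' * (Q' * Q) = P * (P' * Q') * Q := by simp only [Matrix.mul_assoc]
      _ = 1 := by rw [h1', Matrix.mul_one, h1]
  · calc Q' * Q * (P * P') = Q' * (Q * P) * P' := by simp only [Matrix.mul_assoc]
      _ = 1 := by rw [h2, Matrix.mul_one, h2']
  · simp only [Matrix.mul_assoc]

theorem smul (c : ℂ) (h : SimilarMatrices X Y) : SimilarMatrices (c • X) (c • Y) := by
  obtain ⟨P, Q, h1, h2, rfl⟩ := h
  exact ⟨P, Q, h1, h2, by simp⟩

theorem fromBlocks_left (W : Matrix K K ℂ) (h : SimilarMatrices X Y) :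
    SimilarMatrices (Matrix.fromBlocks X 0 0 W) (Matrix.fromBlocks Y 0 0 W) := by
  obtain ⟨P, Q, h1, h2, rfl⟩ := h
  refine ⟨Matrix.fromBlocks P 0 0 1, Matrix.fromBlocks Q 0 0 1, ?_, ?_, ?_⟩ <;>
    simp [Matrix.fromBlocks_multiply, h1, h2, Matrix.fromBlocks_one]

theorem reindex (e : I ≃ J) (X : Matrix I I ℂ) : SimilarMatrices X (X.submatrix e.symm e.symm) := by
  refine ⟨(1 : Matrix I I ℂ).submatrix id e.symm, (1 : Matrix I I ℂ).submatrix e.symm id,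
    ?_, ?_, ?_⟩
  · rw [Matrix.submatrix_mul_equiv]; simp
  · rw [← Matrix.submatrix_mul _ _ _ id _ Function.bijective_id]; simp
  · rw [Matrix.submatrix_mul_equiv, Matrix.submatrix_mul_equiv]; simp

theorem diagonal_comp (e : I ≃ J) (w : J → ℂ) :
    SimilarMatrices (Matrix.diagonal (w ∘ e)) (Matrix.diagonal w) := by
  have := reindex e (Matrix.diagonal (w ∘ e))
  rwa [Matrix.submatrix_diagonal_equiv, Function.comp_assoc, Equiv.self_comp_symm,
    Function.comp_id] at this

theorem toMatrix {V : Type*} [AddCommGroup V] [Module ℂ V] (f : Module.End ℂ V)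
    (b : Module.Basis I ℂ V) (c : Module.Basis J ℂ V) :
    SimilarMatrices (LinearMap.toMatrix b b f) (LinearMap.toMatrix c c f) :=
  ⟨b.toMatrix c, c.toMatrix b, Module.Basis.toMatrix_mul_toMatrix_flip _ _,
    Module.Basis.toMatrix_mul_toMatrix_flip _ _,
    (basis_toMatrix_mul_linearMap_toMatrix_mul_basis_toMatrix b c b c f).symm⟩

theorem exp_diagonal {w : J → ℂ} (h : SimilarMatrices X (Matrix.diagonal w)) :
    SimilarMatrices (NormedSpace.exp X) (Matrix.diagonal fun j => Complex.exp (w j)) := by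
  have hcard : Fintype.card I = Fintype.card J := by
    obtain ⟨P, Q, h1, h2, -⟩ := h
    have e : (J → ℂ) ≃ₗ[ℂ] (I → ℂ) := Matrix.toLin'OfInv h2 h1
    simpa using e.finrank_eq.symm
  -- Exponentials commute with conjugation by a square invertible matrix, so the two index types are
  -- identified first.
  let e : I ≃ J := Fintype.equivOfCardEq hcard
  refine trans ?_ (diagonal_comp e _)
  obtain ⟨P, Q, h1, h2, rfl⟩ := h.trans (diagonal_comp e w).symm
  refine ⟨P, Q, h1, h2, ?_⟩
  rw [← Matrix.inv_eq_right_inv h1, Matrix.exp_conj P _ ⟨⟨P, Q, h1, h2⟩, rfl⟩,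
    Matrix.exp_diagonal]
  congr 3
  ext i
  rw [Pi.coe_exp, Complex.exp_eq_exp_ℂ]
  rfl

end SimilarMatrices

/-! ### Normal forms of the operators -/

theorem similarMatrices_of_aeval_eq_zero {V : Type*} [AddCommGroup V] [Module ℂ V]
    [FiniteDimensional ℂ V] (f : Module.End ℂ V) {ι I : Type*} [Fintype ι] [DecidableEq ι]
    [Fintype I] [DecidableEq I] (b : Module.Basis I ℂ V) (w : ι → ℂ) (hw : Function.Injective w)
    (hf : aeval f (∏ i, (X - C (w i))) = 0) (m : ι → ℕ)
    (hm : ∀ i, Module.finrank ℂ (f.eigenspace (w i)) = m i) :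
    SimilarMatrices (LinearMap.toMatrix b b f)
      (Matrix.diagonal fun s : Σ i, Fin (m i) => w s.1) := by
  obtain rfl : (fun i => Module.finrank ℂ (f.eigenspace (w i))) = m := funext hm
  obtain ⟨c, hc⟩ := exists_eigenbasis f w hw hf
  rw [← toMatrix_eigenbasis f c (fun s => w s.1) hc]
  exact SimilarMatrices.toMatrix f b c

theorem diagTensorId_eq_diagonal {d : ℕ} (w : Fin d → ℂ) (N : ℕ) :
    diagTensorId w N = Matrix.diagonal fun p : Fin d × Fin N => w p.1 := by
  rw [diagTensorId, ← Matrix.diagonal_one, Matrix.diagonal_kronecker_diagonal]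
  simp

theorem similarMatrices_diagTensorId {V : Type*} [AddCommGroup V] [Module ℂ V]
    [FiniteDimensional ℂ V] (f : Module.End ℂ V) {d : ℕ} {I : Type*}
    [Fintype I] [DecidableEq I] (b : Module.Basis I ℂ V) (w : Fin d → ℂ)
    (hw : Function.Injective w) (hf : aeval f (∏ i, (X - C (w i))) = 0) (N : ℕ)
    (hm : ∀ i, Module.finrank ℂ (f.eigenspace (w i)) = N) :
    SimilarMatrices (LinearMap.toMatrix b b f) (diagTensorId w N) := by
  rw [diagTensorId_eq_diagonal]
  exact (similarMatrices_of_aeval_eq_zero f b w hw hf (fun _ => N) hm).trans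
    (SimilarMatrices.diagonal_comp (Equiv.sigmaEquivProd (Fin d) (Fin N)) fun p => w p.1)

/-- `T` is the all-ones matrix minus the identity, and the all-ones matrix squares to `n` times
itself. -/
theorem matT_mul_self (n : ℕ) : matT n * matT n = ((n : ℂ) - 2) • matT n + ((n : ℂ) - 1) • 1 := by
  have e : matT n = Matrix.of (fun _ _ => 1) - 1 := by
    ext i j
    by_cases h : i = j <;> simp [matT, h]
  have e2 : (Matrix.of fun _ _ => 1 : Matrix (Fin n) (Fin n) ℂ) * Matrix.of (fun _ _ => 1) =
      (n : ℂ) • Matrix.of fun _ _ => 1 := by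
    ext i j
    simp [Matrix.mul_apply]
  rw [e, sub_mul, mul_sub, e2, mul_one, one_mul]
  module

/-- `T` has the eigenvalues `n - 1` (once) and `-1` (`n - 1` times). -/
theorem similarMatrices_matT (n : ℕ) (hn : 1 ≤ n) : SimilarMatrices (matT n)
    (Matrix.diagonal fun s : Σ i : Bool, Fin (cond i 1 (n - 1)) =>
      (cond s.1 ((n : ℂ) - 1) (-1) : ℂ)) := by
  set w : Bool → ℂ := fun i => cond i ((n : ℂ) - 1) (-1) with hw
  have hn0 : (n : ℂ) ≠ 0 := Nat.cast_ne_zero.2 (by omega)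
  have hwi : Function.Injective w := by
    intro i j h
    cases i <;> cases j <;> simp [hw] at h ⊢
    · exact hn0 (by linear_combination -h)
    · omega
  set f : Module.End ℂ (Fin n → ℂ) := Matrix.toLin' (matT n) with hf
  have hff : f * f = ((n : ℂ) - 2) • f + ((n : ℂ) - 1) • 1 := by
    rw [hf, Module.End.mul_eq_comp, ← Matrix.toLin'_mul, matT_mul_self, map_add, map_smul, map_smul,
      Matrix.toLin'_one]
    rfl
  have hp : aeval f (∏ i, (X - C (w i))) = 0 := by
    rw [Fintype.prod_bool, map_mul, map_sub, map_sub, aeval_X, aeval_C, aeval_C,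
      Algebra.algebraMap_eq_smul_one, Algebra.algebraMap_eq_smul_one, sub_mul, mul_sub, hff]
    simp only [hw, cond_true, cond_false, smul_mul_assoc, mul_smul_comm, mul_one, one_mul, mul_sub]
    module
  -- The trace and the dimension give two linear equations for the two multiplicities, which
  -- determine them.
  have htr : LinearMap.trace ℂ _ f = 0 := by
    rw [hf, Matrix.trace_toLin'_eq, Matrix.trace]
    simp [matT]
  have h1 := sum_finrank_eigenspace f w hwi hp
  rw [trace_eq_sum_eigenvalues f w hwi hp] at htr
  rw [Fintype.sum_bool] at h1 htr
  rw [Module.finrank_fin_fun] at h1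
  have h3 : Module.finrank ℂ (f.eigenspace (w true)) = 1 := by
    have h1' : (Module.finrank ℂ (f.eigenspace (w true)) : ℂ) +
      Module.finrank ℂ (f.eigenspace (w false)) = n := by exact_mod_cast h1
    have : (n : ℂ) * (Module.finrank ℂ (f.eigenspace (w true)) : ℂ) = n * 1 := by
      have e1 : w true = (n : ℂ) - 1 := rfl
      have e2 : w false = -1 := rfl
      rw [e1, e2] at htr h1'
      rw [e1]
      linear_combination htr + h1'
    exact_mod_cast mul_left_cancel₀ hn0 this
  have := similarMatrices_of_aeval_eq_zero f (Pi.basisFun ℂ (Fin n)) w hwi hp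
    (fun i => cond i 1 (n - 1)) (by
      rintro (_ | _)
      · simp only [cond_false]; omega
      · exact h3)
  rwa [hf, ← Matrix.toLin_eq_toLin', LinearMap.toMatrix_toLin] at this

/-- The eigenvalues `n - 1` and `-1` of `T` are integers, so exponentiating `2 log t` times them
yields honest powers of `t`. -/
theorem similarMatrices_powTwoT (n : ℕ) (hn : 1 ≤ n) (t : ℂˣ) : SimilarMatrices (powTwoT n t)
    (Matrix.diagonal fun s : Σ i : Bool, Fin (cond i 1 (n - 1)) =>
      (cond s.1 ((t : ℂ) ^ (2 * (n - 1))) ((t : ℂ) ^ 2)⁻¹ : ℂ)) := by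
  have h := ((similarMatrices_matT n hn).smul (2 * Complex.log t))
  rw [← Matrix.diagonal_smul] at h
  have h' := h.exp_diagonal
  have ht : Complex.exp (Complex.log t) = t := Complex.exp_log t.ne_zero
  refine cast (congrArg (SimilarMatrices _) (congrArg Matrix.diagonal (funext ?_))) h'
  rintro ⟨_ | _, i⟩
  · simp only [Pi.smul_apply, cond_false, smul_eq_mul, mul_neg, mul_one]
    rw [Complex.exp_neg, two_mul, Complex.exp_add, ht, sq]
  · simp only [Pi.smul_apply, cond_true, smul_eq_mul]
    have : (n : ℂ) - 1 = ((n - 1 : ℕ) : ℂ) := by rw [Nat.cast_sub hn, Nat.cast_one]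
    rw [this]
    conv_rhs => rw [← ht]
    rw [← Complex.exp_nat_mul]
    congr 1; push_cast; ring

/-- The normal form of the last matrix. -/
theorem similarMatrices_fromBlocks {V : Type*} [AddCommGroup V] [Module ℂ V]
    [FiniteDimensional ℂ V] (f : Module.End ℂ V) {n d : ℕ} (hn : 1 ≤ n) {I : Type*}
    [Fintype I] [DecidableEq I] (b : Module.Basis I ℂ V) (t : ℂˣ) (v : ℂ) (w : Fin d → ℂ)
    (w' : Bool ⊕ Fin d → ℂ)
    (hw' : w' = Sum.elim (fun i => v * cond i ((t : ℂ) ^ (2 * (n - 1))) ((t : ℂ) ^ 2)⁻¹) w)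
    (hw : Function.Injective w') (hf : aeval f (∏ i, (X - C (w' i))) = 0)
    (hm : ∀ i, Module.finrank ℂ (f.eigenspace (w' (Sum.inl i))) = cond i 1 (n - 1))
    (hm' : ∀ i, Module.finrank ℂ (f.eigenspace (w' (Sum.inr i))) = n) :
    SimilarMatrices (LinearMap.toMatrix b b f)
      (Matrix.fromBlocks (v • powTwoT n t) 0 0 (diagTensorId w n)) := by
  refine SimilarMatrices.trans ?_
    (SimilarMatrices.fromBlocks_left _ ((similarMatrices_powTwoT n hn t).smul v).symm)
  rw [diagTensorId_eq_diagonal, ← Matrix.diagonal_smul, Matrix.fromBlocks_diagonal]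
  refine (similarMatrices_of_aeval_eq_zero f b w' hw hf
    (Sum.elim (fun i => cond i 1 (n - 1)) fun _ => n)
    (by rintro (i | i); exacts [hm i, hm' i])).trans ?_
  let e : (Σ i : Bool ⊕ Fin d, Fin (Sum.elim (fun i => cond i 1 (n - 1)) (fun _ => n) i : ℕ)) ≃
      (Σ i : Bool, Fin (cond i 1 (n - 1))) ⊕ (Fin d × Fin n) :=
    (Equiv.sumSigmaDistrib _).trans
      (Equiv.sumCongr (Equiv.refl _) (Equiv.sigmaEquivProd (Fin d) (Fin n)))
  refine cast (congrArg₂ SimilarMatrices (congrArg Matrix.diagonal (funext ?_)) rfl)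
    (SimilarMatrices.diagonal_comp e _)
  rintro ⟨i | i, j⟩
  · rw [hw']; rfl
  · rw [hw']; rfl

/-! ## Generic parameters -/

namespace AffineStar

variable (D : AffineStar)

/-- The vertices `(k, j)`. -/
abbrev Vertex : Type := Σ k, Fin (D.d k)

/-- The vertex `(m, ℓ)`. -/
def lastVertex : D.Vertex := ⟨D.lastLeg, lastIdx D.ell⟩

variable {D}

/-- The Laurent monomial with exponents `α` and `β`. -/
def monomialVal (u : D.Params) (t : ℂˣ) (α : D.Vertex → ℤ) (β : ℤ) : ℂˣ :=
  (∏ i : D.Vertex, u i.1 i.2 ^ α i) * t ^ β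

/-- The exponents of a power of `q`. -/
def IsProportional (α : D.Vertex → ℤ) (β : ℤ) : Prop :=
  β = 0 ∧ ∀ i, α i = α D.lastVertex * ((D.ell / D.d i.1 : ℕ) : ℤ)

/-- Among the Laurent monomials with exponents bounded by `B`, only the powers of `q` take the
value `1`. -/
def IsGeneric (B : ℕ) (u : D.Params) (t : ℂˣ) : Prop :=
  ∀ (α : D.Vertex → ℤ) (β : ℤ), (∀ i, |α i| ≤ B) → |β| ≤ B → monomialVal u t α β = 1 →
    IsProportional α β

/-- The numerator of the Laurent polynomial `u^α t^β - 1`. -/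
def binomial (α : D.Vertex → ℤ) (β : ℤ) : MvPolynomial ((Σ k, Fin (D.d k)) ⊕ Unit) ℂ :=
  (∏ i : D.Vertex, MvPolynomial.X (Sum.inl i) ^ (α i).toNat) *
      MvPolynomial.X (Sum.inr ()) ^ β.toNat -
    (∏ i : D.Vertex, MvPolynomial.X (Sum.inl i) ^ (-α i).toNat) *
      MvPolynomial.X (Sum.inr ()) ^ (-β).toNat

theorem pow_toNat_eq (x : ℂˣ) (a : ℤ) :
    (x : ℂ) ^ a.toNat = ((x ^ a : ℂˣ) : ℂ) * (x : ℂ) ^ (-a).toNat := by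
  rw [← Units.val_pow_eq_pow_val, ← Units.val_pow_eq_pow_val, ← Units.val_mul, ← zpow_natCast,
    ← zpow_natCast, ← zpow_add]
  congr 2
  omega

theorem evalAt_binomial_eq_zero_iff (u : D.Params) (t : ℂˣ) (α : D.Vertex → ℤ) (β : ℤ) :
    D.evalAt (binomial α β) u t = 0 ↔ monomialVal u t α β = 1 := by
  set y : ℂˣ := (∏ i : D.Vertex, u i.1 i.2 ^ (-α i).toNat) * t ^ (-β).toNat with hy
  have h : D.evalAt (binomial α β) u t = ((monomialVal u t α β : ℂ) - 1) * y := by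
    simp only [evalAt, binomial, map_sub, map_mul, map_prod, map_pow, MvPolynomial.eval_X,
      Sum.elim_inl, Sum.elim_inr]
    rw [Finset.prod_congr rfl fun i _ => pow_toNat_eq (u i.1 i.2) (α i), pow_toNat_eq t β,
      Finset.prod_mul_distrib, monomialVal, hy]
    simp only [Units.val_mul, Units.coe_prod, Units.val_pow_eq_pow_val]
    ring
  rw [h, mul_eq_zero, or_iff_left y.ne_zero, sub_eq_zero, Units.val_eq_one]

theorem monomialVal_neg_eq_q (u : D.Params) (t : ℂˣ) :
    monomialVal u t (fun i => -((D.ell / D.d i.1 : ℕ) : ℤ)) 0 = D.q u := by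
  rw [monomialVal, zpow_zero, mul_one, q, Fintype.prod_sigma]

/-- There are parameters with `q(u) = 1` which satisfy no further monomial relation. -/
theorem exists_isGeneric : ∃ (u : D.Params) (t : ℂˣ), D.q u = 1 ∧
    ∀ α β, monomialVal u t α β = 1 → IsProportional α β := by
  classical
  set c : D.Vertex → ℤ := fun i => ((D.ell / D.d i.1 : ℕ) : ℤ) with hc
  have hcl : c D.lastVertex = 1 := by
    simp only [hc, lastVertex]
    rw [Nat.div_self (D.d_pos _), Nat.cast_one]
  -- The parameters will be exponentials of real numbers, which turns multiplicative relations among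
  -- them into rational linear relations among the exponents.
  obtain ⟨w, hw⟩ : ∃ w : D.Vertex ⊕ Unit → ℝ, LinearIndependent ℚ w := by
    obtain ⟨w, hw⟩ := exists_linearIndependent_of_le_rank (R := ℚ) (M := ℝ)
      (n := Fintype.card (D.Vertex ⊕ Unit)) (by
        rw [Real.rank_rat_real]; exact (Cardinal.nat_lt_continuum _).le)
    exact ⟨w ∘ Fintype.equivFin _, hw.comp _ (Equiv.injective _)⟩
  set S : ℝ := ∑ j, (c j : ℝ) * w (Sum.inl j) with hS
  -- Changing the last coordinate by `S` enforces `∑ c_i W_i = 0`, that is `q(u) = 1`, because `c`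
  -- is `1` at the last vertex.
  set W : D.Vertex → ℝ := fun i => w (Sum.inl i) - if i = D.lastVertex then S else 0 with hW
  set u : D.Params := fun k j => Units.mk0 ((Real.exp (W ⟨k, j⟩) : ℝ) : ℂ)
    (Complex.ofReal_ne_zero.2 (Real.exp_ne_zero _)) with hu
  set t : ℂˣ := Units.mk0 ((Real.exp (w (Sum.inr ())) : ℝ) : ℂ)
    (Complex.ofReal_ne_zero.2 (Real.exp_ne_zero _)) with ht
  have hval (α : D.Vertex → ℤ) (β : ℤ) : monomialVal u t α β = 1 ↔
      ∑ i, ((α i - α D.lastVertex * c i : ℤ) : ℝ) * w (Sum.inl i) +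
        (β : ℝ) * w (Sum.inr ()) = 0 := by
    have h1 : (monomialVal u t α β : ℂ) =
        ((Real.exp (∑ i, (α i : ℝ) * W i + β * w (Sum.inr ())) : ℝ) : ℂ) := by
      have hexp (a : ℤ) (x : ℝ) : Real.exp (a * x) = Real.exp x ^ a := by
        rw [mul_comm, Real.exp_mul, Real.rpow_intCast]
      rw [Real.exp_add, Real.exp_sum, monomialVal]
      simp only [Units.val_mul, Units.coe_prod, Units.val_zpow_eq_zpow_val, hu, ht, Units.val_mk0,
        Complex.ofReal_mul, Complex.ofReal_prod, hexp, Complex.ofReal_zpow]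
    have h2 : ∑ i, (α i : ℝ) * W i =
        ∑ i, ((α i - α D.lastVertex * c i : ℤ) : ℝ) * w (Sum.inl i) := by
      simp only [hW, mul_sub, Finset.sum_sub_distrib, mul_ite, mul_zero, Finset.sum_ite_eq',
        Finset.mem_univ, if_true, Int.cast_sub, Int.cast_mul, sub_mul, hS, Finset.mul_sum, mul_assoc]
    rw [← Units.val_eq_one, h1, h2, Complex.ofReal_eq_one, Real.exp_eq_one_iff]
  refine ⟨u, t, ?_, fun α β h => ?_⟩
  · rw [← monomialVal_neg_eq_q u t, hval]
    have h0 : ∀ i, -c i - -c D.lastVertex * c i = 0 := fun i => by rw [hcl]; ring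
    simp only [hc] at h0 ⊢
    simp only [h0]
    simp
  · rw [hval] at h
    have hli := Fintype.linearIndependent_iff.1 hw
      (Sum.elim (fun i => ((α i - α D.lastVertex * c i : ℤ) : ℚ)) fun _ => (β : ℚ)) (by
        rw [Fintype.sum_sum_type, ← h]
        simp [Rat.smul_def])
    refine ⟨?_, fun i => ?_⟩
    · have := hli (Sum.inr ())
      simpa using this
    · have := hli (Sum.inl i)
      simp only [Sum.elim_inl, Int.cast_eq_zero] at this
      exact sub_eq_zero.1 this

/-- Only finitely many bounded exponents are not proportional to those of `q`. The product of their
binomials defines the open set, and one point satisfying no relation beyond powers of `q` shows that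
it is nonempty. -/
theorem forGenericParams_isGeneric (B : ℕ) : D.ForGenericParams (IsGeneric B) := by
  classical
  set s : Finset ((D.Vertex → ℤ) × ℤ) :=
    ((Fintype.piFinset fun _ => Finset.Icc (-(B : ℤ)) B) ×ˢ Finset.Icc (-(B : ℤ)) B).filter
      fun x => ¬ IsProportional x.1 x.2 with hs
  have hev (u : D.Params) (t : ℂˣ) : D.evalAt (∏ x ∈ s, binomial x.1 x.2) u t ≠ 0 ↔
      ∀ x ∈ s, monomialVal u t x.1 x.2 ≠ 1 := by
    rw [evalAt, map_prod, Finset.prod_ne_zero_iff]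
    exact forall₂_congr fun x _ => (evalAt_binomial_eq_zero_iff u t x.1 x.2).not
  refine ⟨∏ x ∈ s, binomial x.1 x.2, ?_, fun u t _ h α β hα hβ h1 => ?_⟩
  · obtain ⟨u, t, hq, h⟩ := exists_isGeneric (D := D)
    exact ⟨u, t, hq, (hev u t).2 fun x hx h1 => (Finset.mem_filter.1 hx).2 (h _ _ h1)⟩
  · by_contra hp
    refine (hev u t).1 h (α, β) (Finset.mem_filter.2 ⟨Finset.mem_product.2 ⟨?_, ?_⟩, hp⟩) h1
    · exact Fintype.mem_piFinset.2 fun i => Finset.mem_Icc.2 (abs_le.1 (hα i))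
    · exact Finset.mem_Icc.2 (abs_le.1 hβ)

end AffineStar

/-! ## The Ariki–Koike algebra -/

theorem prod_eq_lastIdx_mul {M : Type*} [CommMonoid M] {ℓ : ℕ} [NeZero ℓ] (f : Fin ℓ → M) :
    ∏ j, f j = f (lastIdx ℓ) * ∏ j : Fin (ℓ - 1), f (j.castLE (Nat.sub_le _ 1)) := by
  obtain ⟨k, rfl⟩ : ∃ k, ℓ = k + 1 := ⟨ℓ - 1, by have := NeZero.pos ℓ; omega⟩
  rw [Fin.prod_univ_castSucc, mul_comm]
  rfl

theorem jucysMurphy_eq {A : Type*} [Ring A] (N : ℕ) (T : ℕ → A) (U : A) :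
    jucysMurphy T U N = descProd (fun i : Fin N => T i) * U * ascProd (fun i : Fin N => T i) := by
  induction N with
  | zero => simp [jucysMurphy, descProd, ascProd]
  | succ N ih =>
    rw [jucysMurphy, ih, descProd_succ', ascProd_succ']
    simp only [Fin.val_last, Fin.val_castSucc, mul_assoc]

namespace ArikiKoike

variable (n ℓ : ℕ) (v : Fin ℓ → ℂˣ) (t : ℂˣ)

/-- The generators `T_i`, indexed by all natural numbers. -/
def natT (i : ℕ) : ArikiKoike n ℓ v t := if h : i < n - 1 then T n ℓ v t ⟨i, h⟩ else 1

/-- The product of the factors `X - v_j` with `j < ℓ`. -/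
def cofactor : ℂ[X] := ∏ j : Fin (ℓ - 1), (X - C (v (j.castLE (Nat.sub_le _ 1)) : ℂ))

theorem monic_cofactor : (cofactor ℓ v).Monic := monic_prod_of_monic _ _ fun _ _ => monic_X_sub_C _

theorem natDegree_cofactor : (cofactor ℓ v).natDegree = ℓ - 1 := by
  rw [cofactor, natDegree_prod_of_monic _ _ fun _ _ => monic_X_sub_C _]
  simp

variable {n ℓ v t}

theorem natT_of_lt {i : ℕ} (h : i < n - 1) : natT n ℓ v t i = T n ℓ v t ⟨i, h⟩ := dif_pos h

theorem mk_rel {x y : Free n} (h : Rel n ℓ v t x y) :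
    RingQuot.mkAlgHom ℂ (Rel n ℓ v t) x = RingQuot.mkAlgHom ℂ (Rel n ℓ v t) y :=
  RingQuot.mkAlgHom_rel ℂ h

/-- The inverse generators are thus redundant, and the algebra is generated by `U` and the `T_i`. -/
theorem mk_fTinv (i : Fin (n - 1)) : RingQuot.mkAlgHom ℂ (Rel n ℓ v t) (fTinv i) =
    T n ℓ v t i - algebraMap ℂ _ ((t : ℂ) - (t : ℂ)⁻¹) := by
  have h := mk_rel (Rel.quad (v := v) (t := t) i)
  rw [map_sub, AlgHom.commutes] at h
  rw [← h, T]; abel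

theorem heckeRelations [NeZero ℓ] : HeckeRelations (n - 1) (t : ℂ) (v (lastIdx ℓ) : ℂ)
    (cofactor ℓ v) (natT n ℓ v t) (U n ℓ v t) where
  quad i hi := by
    have h := mk_rel (Rel.T_mul_inv (v := v) (t := t) ⟨i, hi⟩)
    rw [map_mul, map_one, mk_fTinv, mul_sub, sub_eq_iff_eq_add, ← Algebra.commutes,
      ← Algebra.smul_def] at h
    rw [natT_of_lt hi, add_comm]
    exact h
  braid i hi := by
    rw [natT_of_lt hi, natT_of_lt (show i < n - 1 by omega)]
    simpa [T] using mk_rel (Rel.braid (v := v) (t := t) ⟨i, by omega⟩ ⟨i + 1, hi⟩ rfl)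
  comm i j hij hj := by
    rw [natT_of_lt hj, natT_of_lt (show i < n - 1 by omega)]
    simpa [T] using mk_rel (Rel.comm_TT (v := v) (t := t) ⟨i, by omega⟩ ⟨j, hj⟩ (Or.inl hij))
  comm_U i hi hN := by
    rw [natT_of_lt hN]
    simpa [T, U] using mk_rel (Rel.comm_UT (v := v) (t := t) ⟨i, hN⟩ hi)
  UTUT h := by
    rw [natT_of_lt h]
    simpa [T, U] using mk_rel (Rel.UTUT (v := v) (t := t) ⟨0, h⟩ rfl)
  poly := by
    have h := mk_rel (Rel.poly (n := n) (v := v) (t := t))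
    rw [← Polynomial.aeval_algHom_apply, map_zero, prod_eq_lastIdx_mul] at h
    exact h

theorem adjoin_eq_top : Algebra.adjoin ℂ
    ({U n ℓ v t} ∪ natT n ℓ v t '' Set.Iio (n - 1)) = ⊤ := by
  refine eq_top_iff.2 fun a _ => ?_
  obtain ⟨p, rfl⟩ := RingQuot.mkAlgHom_surjective ℂ (Rel n ℓ v t) a
  have hT (i : Fin (n - 1)) : T n ℓ v t i ∈ Algebra.adjoin ℂ
      ({U n ℓ v t} ∪ natT n ℓ v t '' Set.Iio (n - 1)) :=
    Algebra.subset_adjoin (Or.inr ⟨i, i.2, natT_of_lt i.2⟩)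
  induction p using FreeAlgebra.induction with
  | grade0 c => rw [AlgHom.commutes]; exact Subalgebra.algebraMap_mem _ c
  | grade1 x =>
    cases x with
    | T i => exact hT i
    | Tinv i => rw [mk_fTinv]; exact sub_mem (hT i) (Subalgebra.algebraMap_mem _ _)
    | U => exact Algebra.subset_adjoin (Or.inl rfl)
  | mul a b ha hb => rw [map_mul]; exact mul_mem (ha trivial) (hb trivial)
  | add a b ha hb => rw [map_add]; exact add_mem (ha trivial) (hb trivial)

theorem triv_U [NeZero ℓ] : triv n ℓ v t (U n ℓ v t) = v (lastIdx ℓ) := by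
  simp [triv, U, RingQuot.liftAlgHom_mkAlgHom_apply, charGen]

theorem triv_T [NeZero ℓ] (i : Fin (n - 1)) : triv n ℓ v t (T n ℓ v t i) = t := by
  simp [triv, T, RingQuot.liftAlgHom_mkAlgHom_apply, charGen]

/-- The eigenvectors of the subalgebra `𝐇_{n-1,ℓ}` for the trivial character. -/
theorem mem_invariants_iff [NeZero ℓ] (hn : 2 ≤ n) (x : ArikiKoike n ℓ v t) :
    x ∈ HeckeRelations.invariants (t : ℂ) (v (lastIdx ℓ) : ℂ) (natT n ℓ v t) (U n ℓ v t) (n - 1) ↔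
      ∀ h ∈ sub n ℓ v t, h * x = triv n ℓ v t h • x := by
  constructor
  · rintro ⟨hU, hT⟩ h hh
    unfold sub at hh
    induction hh using Algebra.adjoin_induction with
    | mem y hy =>
      rcases hy with rfl | ⟨i, hi, rfl⟩
      · rw [triv_U]; exact hU (by omega)
      · rw [triv_T, ← hT i hi, natT_of_lt i.2]
    | algebraMap c => rw [AlgHom.commutes, ← Algebra.smul_def]; rfl
    | add y z _ _ hy hz => rw [map_add, add_mul, hy, hz, add_smul]
    | mul y z _ _ hy hz =>
      rw [map_mul, mul_assoc, hz, mul_smul_comm, hy, smul_smul, mul_comm]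
  · intro h
    refine ⟨fun _ => ?_, fun i hi => ?_⟩
    · rw [h _ (Algebra.subset_adjoin (Or.inl rfl)), triv_U]
    · have hi' : i < n - 1 := by omega
      rw [natT_of_lt hi', h _ (Algebra.subset_adjoin (Or.inr ⟨⟨i, hi'⟩, hi, rfl⟩)), triv_T]

end ArikiKoike

/-! ## The operators `Ũ_k` -/

namespace GDAHA

variable {D : AffineStar} {n : ℕ} {u : D.Params} {t : ℂˣ}

theorem eta_U : eta D n u t (ArikiKoike.U n D.ell (u D.lastLeg) t) = U D n u t D.lastLeg := by
  simp only [eta, ArikiKoike.U, RingQuot.liftAlgHom_mkAlgHom_apply, FreeAlgebra.lift_ι_apply,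
    etaGen]

theorem eta_T (i) : eta D n u t (ArikiKoike.T n D.ell (u D.lastLeg) t i) = T D n u t i := by
  simp only [eta, ArikiKoike.T, RingQuot.liftAlgHom_mkAlgHom_apply, FreeAlgebra.lift_ι_apply,
    etaGen]

/-- The last Jucys–Murphy element of the Ariki–Koike algebra. -/
abbrev jmLast (D : AffineStar) (n : ℕ) (u : D.Params) (t : ℂˣ) :
    ArikiKoike n D.ell (u D.lastLeg) t :=
  jucysMurphy (ArikiKoike.natT n D.ell (u D.lastLeg) t) (ArikiKoike.U n D.ell (u D.lastLeg) t)
    (n - 1)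

/-- This moves the computation of the spectrum of `Ũ_m` on `V'` into the Ariki–Koike algebra. -/
theorem eta_jmLast : eta D n u t (jmLast D n u t) = tildeU D n u t D.lastLeg := by
  have hd : (fun i : Fin (n - 1) => ArikiKoike.natT n D.ell (u D.lastLeg) t i) =
      ArikiKoike.T n D.ell (u D.lastLeg) t := funext fun i => ArikiKoike.natT_of_lt i.2
  rw [jmLast, jucysMurphy_eq, hd, tildeU, if_pos rfl, map_mul, map_mul, eta_U]
  have h : ∀ l : List (Fin (n - 1)),
      eta D n u t (l.map (ArikiKoike.T n D.ell (u D.lastLeg) t)).prod =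
        (l.map (T D n u t)).prod := fun l => by
    rw [map_list_prod, List.map_map]
    exact congrArg List.prod (List.map_congr_left fun i _ => eta_T i)
  congr 1
  · congr 1
    simp only [descProd, List.ofFn_eq_map, ← List.map_reverse]
    exact h _
  · simp only [ascProd, List.ofFn_eq_map]
    exact h _

theorem aeval_conj {A : Type*} [Ring A] [Algebra ℂ A] {a b x : A} (h : b * a = 1)
    (h' : a * b = 1) (p : ℂ[X]) : aeval (a * x * b) p = a * aeval x p * b := by
  have := aeval_semiconj (τ := a) (x := x) (y := a * x * b)
    (by rw [mul_assoc (a * x), h, mul_one]) p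
  rw [this, mul_assoc _ a b, h', mul_one]

theorem aeval_tildeU (k : Fin D.m) (hk : k ≠ D.lastLeg) :
    aeval (tildeU D n u t k) (∏ j, (X - C (u k j : ℂ))) = 0 := by
  have h := mk_rel (Rel.poly (D := D) (n := n) (u := u) (t := t) k)
  rw [← Polynomial.aeval_algHom_apply, map_zero] at h
  rw [tildeU, if_neg hk, aeval_conj (ascProd_mul_descProd _ _ Tinv_mul_T)
    (descProd_mul_ascProd _ _ T_mul_Tinv)]
  have h' : aeval (U D n u t k) (∏ j, (X - C (u k j : ℂ))) = 0 := h
  rw [h', mul_zero, zero_mul]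

theorem prod_ofFn_conj {A : Type*} [Monoid A] {a b : A} (h : b * a = 1) {r : ℕ} (x : Fin r → A) :
    (List.ofFn fun i => a * x i * b).prod * a = a * (List.ofFn x).prod := by
  induction r with
  | zero => simp
  | succ r ih =>
    rw [List.ofFn_succ, List.ofFn_succ, List.prod_cons, List.prod_cons, mul_assoc, ih]
    set y := (List.ofFn fun i => x i.succ).prod
    calc a * x 0 * b * (a * y) = a * x 0 * (b * a) * y := by simp only [mul_assoc]
      _ = _ := by rw [h, mul_one, mul_assoc]

/-- With `a = T_{n-1} ⋯ T_1`, the conjugations of the first `m - 1` factors telescope. The product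
is `a` times the left side of the sphere relation times `a⁻¹`. -/
theorem prod_tildeU : (List.ofFn (tildeU D n u t)).prod = 1 := by
  have hs := mk_rel (Rel.sphere (D := D) (n := n) (u := u) (t := t))
  have h1 := descProd_mul_ascProd _ _ (T_mul_Tinv (D := D) (n := n) (u := u) (t := t))
  have h2 := ascProd_mul_descProd _ _ (Tinv_mul_T (D := D) (n := n) (u := u) (t := t))
  have hs' : (List.ofFn (U D n u t)).prod * (ascProd (T D n u t) * descProd (T D n u t)) = 1 := by
    rw [map_one, map_mul, map_mul, ascProd, descProd, map_list_prod, map_list_prod, map_list_prod,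
      List.map_reverse, List.map_ofFn, List.map_ofFn] at hs
    exact hs
  rw [List.ofFn_succ', List.concat_eq_append, List.prod_append, List.prod_singleton] at hs' ⊢
  have e1 : (fun i : Fin D.r => tildeU D n u t i.castSucc) = fun i : Fin D.r =>
      descProd (T D n u t) * U D n u t i.castSucc * ascProd (Tinv D n u t) := by
    ext i
    rw [tildeU, if_neg (Fin.castSucc_lt_last i).ne]
  have e2 : tildeU D n u t (Fin.last D.r) =
      descProd (T D n u t) * U D n u t (Fin.last D.r) * ascProd (T D n u t) := by
    rw [tildeU, if_pos rfl]
  rw [e1, e2]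
  set a := descProd (T D n u t)
  set b := ascProd (Tinv D n u t)
  have e3 := prod_ofFn_conj h2 fun i : Fin D.r => U D n u t i.castSucc
  set P := (List.ofFn fun i : Fin D.r => U D n u t i.castSucc).prod
  set Q := (List.ofFn fun i : Fin D.r => a * U D n u t i.castSucc * b).prod
  calc Q * (a * U D n u t (Fin.last D.r) * ascProd (T D n u t))
      = Q * a * U D n u t (Fin.last D.r) * ascProd (T D n u t) * (a * b) := by
        rw [h1]; simp only [mul_assoc, mul_one]
    _ = a * (P * U D n u t (Fin.last D.r) * (ascProd (T D n u t) * a)) * b := by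
        rw [e3]; simp only [mul_assoc]
    _ = 1 := by rw [hs', mul_one, h1]

end GDAHA

/-! ### The operators restricted to `V'` -/

namespace RegularIrrep

variable {D : AffineStar} {n : ℕ} {u : D.Params} {t : ℂˣ}

theorem coe_tildeU_apply (hn : 2 ≤ n) (V : RegularIrrep D n u t) (k : Fin D.m)
    (x : V.primeSpace) : (V.tildeU hn k x : V.carrier) = GDAHA.tildeU D n u t k • (x : V.carrier) :=
  rfl

theorem coe_aeval_tildeU_apply (hn : 2 ≤ n) (V : RegularIrrep D n u t) (k : Fin D.m) (p : ℂ[X])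
    (x : V.primeSpace) : (aeval (V.tildeU hn k) p x : V.carrier) =
      aeval (GDAHA.tildeU D n u t k) p • (x : V.carrier) := by
  induction p using Polynomial.induction_on' with
  | add p q hp hq =>
    rw [map_add, map_add, LinearMap.add_apply, Submodule.coe_add, hp, hq, add_smul]
  | monomial j c =>
    have hj : ∀ x : V.primeSpace, ((V.tildeU hn k ^ j) x : V.carrier) =
        GDAHA.tildeU D n u t k ^ j • (x : V.carrier) := by
      induction j with
      | zero => intro x; simp
      | succ j ih =>
        intro x
        rw [pow_succ, Module.End.mul_apply, ih, coe_tildeU_apply, smul_smul, pow_succ]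
    rw [aeval_monomial, aeval_monomial, ← Algebra.smul_def, ← Algebra.smul_def,
      LinearMap.smul_apply, Submodule.coe_smul, hj, smul_assoc]

theorem aeval_tildeU (hn : 2 ≤ n) (V : RegularIrrep D n u t) (k : Fin D.m) (hk : k ≠ D.lastLeg) :
    aeval (V.tildeU hn k) (∏ j, (X - C (u k j : ℂ))) = 0 := by
  ext x
  rw [coe_aeval_tildeU_apply, GDAHA.aeval_tildeU k hk, zero_smul]
  rfl

theorem prod_tildeU (hn : 2 ≤ n) (V : RegularIrrep D n u t) :
    (List.ofFn (V.tildeU hn)).prod = 1 := by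
  have key : ∀ (l : List (Fin D.m)) (x : V.primeSpace),
      ((l.map (V.tildeU hn)).prod x : V.carrier) =
        (l.map (GDAHA.tildeU D n u t)).prod • (x : V.carrier) := by
    intro l
    induction l with
    | nil => intro x; simp
    | cons k l ih =>
      intro x
      rw [List.map_cons, List.prod_cons, Module.End.mul_apply, coe_tildeU_apply, ih, smul_smul,
        List.map_cons, List.prod_cons]
  ext x
  rw [List.ofFn_eq_map, key, ← List.ofFn_eq_map, GDAHA.prod_tildeU, one_smul]
  rfl

/-- `V'` is the image of the space of invariants in the regular representation. -/
theorem exists_equiv_invariants (hn : 2 ≤ n) (V : RegularIrrep D n u t) :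
    ∃ e : HeckeRelations.invariants (t : ℂ) (u D.lastLeg (lastIdx D.ell) : ℂ)
        (ArikiKoike.natT n D.ell (u D.lastLeg) t) (ArikiKoike.U n D.ell (u D.lastLeg) t) (n - 1)
          ≃ₗ[ℂ] V.primeSpace,
      ∀ (x) (p : ℂ[X]), aeval (GDAHA.jmLast D n u t) p * x.1 = 0 →
        aeval (V.tildeU hn D.lastLeg) p (e x) = 0 := by
  obtain ⟨φ, hφ⟩ := V.regular
  have hmap : (HeckeRelations.invariants (t : ℂ) (u D.lastLeg (lastIdx D.ell) : ℂ)
      (ArikiKoike.natT n D.ell (u D.lastLeg) t) (ArikiKoike.U n D.ell (u D.lastLeg) t)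
        (n - 1)).map φ.toLinearMap = V.primeSpace := by
    ext y
    obtain ⟨x, rfl⟩ := φ.surjective y
    have h1 : φ x ∈ V.primeSpace ↔ ∀ h ∈ ArikiKoike.sub n D.ell (u D.lastLeg) t,
        h * x = ArikiKoike.triv n D.ell (u D.lastLeg) t h • x := by
      refine forall₂_congr fun h _ => ?_
      rw [← hφ, ← map_smul]
      exact φ.injective.eq_iff
    rw [h1, ← ArikiKoike.mem_invariants_iff hn]
    exact (Submodule.mem_map_equiv _).trans (by rw [LinearEquiv.symm_apply_apply])
  refine ⟨(φ.submoduleMap _).trans (LinearEquiv.ofEq _ _ hmap), fun x p hp => ?_⟩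
  refine Subtype.ext ?_
  rw [coe_aeval_tildeU_apply, ← GDAHA.eta_jmLast, Polynomial.aeval_algHom_apply]
  change GDAHA.eta D n u t (aeval (GDAHA.jmLast D n u t) p) • φ x.1 = 0
  rw [← hφ, hp, map_zero]

end RegularIrrep

/-! ### Consequences of genericity for the eigenvalues -/

namespace AffineStar

variable {D : AffineStar}

theorem two_le_d (k : Fin D.m) : 2 ≤ D.d k := by
  have h : D.d k ∈ Finset.univ.val.map D.d := Multiset.mem_map.2 ⟨k, Finset.mem_univ k, rfl⟩
  rcases D.shape with e | e | e | e <;> rw [e] at h <;> simp at h <;> omega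

/-- Checked shape by shape; it ensures that the natural-number quotients `ℓ / d_k` are exact. -/
theorem d_dvd_ell (k : Fin D.m) : D.d k ∣ D.ell := by
  have h (k) : D.d k ∈ Finset.univ.val.map D.d := Multiset.mem_map.2 ⟨k, Finset.mem_univ k, rfl⟩
  have hle : ∀ x ∈ Finset.univ.val.map D.d, x ≤ D.ell := fun x hx => by
    obtain ⟨k, -, rfl⟩ := Multiset.mem_map.1 hx
    exact D.le_last k
  have h1 := h k
  have h2 : D.ell ∈ Finset.univ.val.map D.d := h D.lastLeg
  clear h
  generalize D.d k = x at h1 ⊢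
  generalize D.ell = y at h2 hle ⊢
  rcases D.shape with e | e | e | e <;> rw [e] at h1 h2 hle <;> simp at h1 h2 hle <;>
    (have hx : x = 2 ∨ x = 3 ∨ x = 4 ∨ x = 6 := by omega) <;>
    rcases hx with rfl | rfl | rfl | rfl <;> omega

/-- Equality would give value `1` to a monomial with exponents `1` at `i` and `-1` at `j`, whereas
the exponents of a power of `q` never have opposite signs. -/
theorem IsGeneric.ne {B : ℕ} {u : D.Params} {t : ℂˣ} (G : IsGeneric B u t) {i j : D.Vertex}
    (hij : i ≠ j) {c : ℤ} (hc : |c| ≤ B) (hB : 1 ≤ B) : u i.1 i.2 ≠ u j.1 j.2 * t ^ c := by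
  classical
  intro h
  have hprod (i : D.Vertex) : ∏ x : D.Vertex, u x.1 x.2 ^ (Pi.single i (1 : ℤ) : D.Vertex → ℤ) x =
      u i.1 i.2 := by
    rw [Finset.prod_eq_single i (fun x _ hx => by rw [Pi.single_eq_of_ne hx, zpow_zero])
      (fun h => absurd (Finset.mem_univ i) h), Pi.single_eq_same, zpow_one]
  have hP := G (Pi.single i 1 - Pi.single j 1) (-c) (fun x => by
    have hB' : (1 : ℤ) ≤ B := by exact_mod_cast hB
    refine le_trans ?_ hB'
    rw [Pi.sub_apply, Pi.single_apply, Pi.single_apply]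
    split_ifs <;> simp) (by rwa [abs_neg]) (by
    simp only [monomialVal, Pi.sub_apply, zpow_sub, Finset.prod_mul_distrib, Finset.prod_inv_distrib,
      hprod, h, zpow_neg]
    rw [mul_inv_cancel_comm, mul_inv_cancel])
  have h1 := hP.2 i
  have h2 := hP.2 j
  rw [Pi.sub_apply, Pi.single_eq_same, Pi.single_eq_of_ne hij, sub_zero] at h1
  rw [Pi.sub_apply _ _ j, Pi.single_eq_same, Pi.single_eq_of_ne hij.symm] at h2
  have c1 : (0 : ℤ) ≤ ((D.ell / D.d i.1 : ℕ) : ℤ) := Int.natCast_nonneg _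
  have c2 : (0 : ℤ) ≤ ((D.ell / D.d j.1 : ℕ) : ℤ) := Int.natCast_nonneg _
  rcases le_total 0 ((Pi.single i 1 - Pi.single j 1 : D.Vertex → ℤ) D.lastVertex) with h0 | h0
  · linarith [mul_nonneg h0 c2]
  · linarith [mul_nonpos_of_nonpos_of_nonneg h0 c1]

theorem IsGeneric.t_zpow_ne {B : ℕ} {u : D.Params} {t : ℂˣ} (G : IsGeneric B u t) {c : ℤ}
    (hc0 : c ≠ 0) (hc : |c| ≤ B) : t ^ c ≠ 1 := fun h =>
  hc0 (G 0 c (fun i => by simp) hc (by simp [monomialVal, h])).1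

theorem IsGeneric.ne_mul_pow {B : ℕ} {u : D.Params} {t : ℂˣ} (G : IsGeneric B u t)
    {i j : D.Vertex} (hij : i ≠ j) {c : ℕ} (hc : c ≤ B) (hB : 1 ≤ B) :
    (u i.1 i.2 : ℂ) ≠ u j.1 j.2 * (t : ℂ) ^ c := by
  intro h
  refine G.ne hij (c := c) (by rw [Nat.abs_cast]; exact_mod_cast hc) hB (Units.ext ?_)
  rw [h]; simp

theorem castLE_ne_lastIdx {ℓ : ℕ} [NeZero ℓ] (j : Fin (ℓ - 1)) :
    j.castLE (Nat.sub_le ℓ 1) ≠ lastIdx ℓ := fun h => by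
  have h1 := congrArg Fin.val h
  have h2 := j.2
  simp only [lastIdx, Fin.val_castLE] at h1
  omega

theorem mk_castLE_ne_lastVertex (j : Fin (D.ell - 1)) :
    (⟨D.lastLeg, j.castLE (Nat.sub_le _ 1)⟩ : D.Vertex) ≠ D.lastVertex := fun h =>
  castLE_ne_lastIdx j (eq_of_heq (Sigma.mk.inj h).2)

theorem IsGeneric.injective {B : ℕ} {u : D.Params} {t : ℂˣ} (G : IsGeneric B u t) (hB : 1 ≤ B)
    (k : Fin D.m) : Function.Injective fun j => (u k j : ℂ) := by
  intro i j hij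
  by_contra hne
  refine G.ne_mul_pow (i := ⟨k, i⟩) (j := ⟨k, j⟩) (c := 0) (fun h => ?_) (Nat.zero_le _) hB
    (by simpa using hij)
  exact hne (eq_of_heq (Sigma.mk.inj h).2)

/-- The bound `2n + 2` is the largest power of `t` needed, `t^{2j}` with `j = (n - 1) + 2`. -/
theorem IsGeneric.heckeGeneric {B n : ℕ} {u : D.Params} {t : ℂˣ} (G : IsGeneric B u t)
    (hn : 2 ≤ n) (hB : 2 * n + 2 ≤ B) :
    HeckeGeneric (n - 1) (t : ℂ) (u D.lastLeg (lastIdx D.ell) : ℂ)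
      (ArikiKoike.cofactor D.ell (u D.lastLeg)) where
  t_ne := t.ne_zero
  v_ne := Units.ne_zero _
  t_pow j h0 hj h := by
    refine G.t_zpow_ne (c := (2 * j : ℕ)) (by omega) ?_ ?_
    · rw [Nat.abs_cast]; exact_mod_cast (by omega)
    · rw [zpow_natCast]; exact Units.ext (by simpa using h)
  F_eval j hj := by
    rw [ArikiKoike.cofactor, eval_prod]
    refine Finset.prod_ne_zero_iff.2 fun i _ => ?_
    rw [eval_sub, eval_X, eval_C]
    exact sub_ne_zero.2 (G.ne_mul_pow (mk_castLE_ne_lastVertex i) (j := D.lastVertex)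
      (by omega) (by omega)).symm

/-- The eigenvalues of `Ũ_m` on `V'`. -/
def lastEigenvalue (n : ℕ) (u : D.Params) (t : ℂˣ) : Bool ⊕ Fin (D.ell - 1) → ℂ :=
  Sum.elim (fun i => (u D.lastLeg (lastIdx D.ell) : ℂ) *
      cond i ((t : ℂ) ^ (2 * (n - 1))) ((t : ℂ) ^ 2)⁻¹)
    fun j => (u D.lastLeg (j.castLE (Nat.sub_le _ 1)) : ℂ)

/-- Since `n ≥ 2`, the index `n - 1` is a successor, so the factor `X - v t⁻²` is present in the
cofactor. -/
theorem prod_lastEigenvalue {n : ℕ} (hn : 2 ≤ n) (u : D.Params) (t : ℂˣ) :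
    ∏ i, (X - C (lastEigenvalue n u t i)) =
      jmPoly (t : ℂ) (u D.lastLeg (lastIdx D.ell) : ℂ)
        (ArikiKoike.cofactor D.ell (u D.lastLeg)) (n - 1) := by
  obtain ⟨k, rfl⟩ : ∃ k, n = k + 2 := ⟨n - 2, by omega⟩
  rw [Fintype.prod_sum_type, Fintype.prod_bool, mul_assoc]
  rfl

theorem IsGeneric.injective_lastEigenvalue {B n : ℕ} {u : D.Params} {t : ℂˣ}
    (G : IsGeneric B u t) (hn : 2 ≤ n) (hB : 2 * n + 2 ≤ B) :
    Function.Injective (lastEigenvalue n u t) := by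
  have ht := t.ne_zero
  have hv := (u D.lastLeg (lastIdx D.ell)).ne_zero
  have h1 : (u D.lastLeg (lastIdx D.ell) : ℂ) * (t : ℂ) ^ (2 * (n - 1)) ≠
      (u D.lastLeg (lastIdx D.ell) : ℂ) * ((t : ℂ) ^ 2)⁻¹ :=
    sub_ne_zero.1 ((G.heckeGeneric hn hB).sub_inv_ne (n - 1) (by omega))
  have h2 (j : Fin (D.ell - 1)) (i : Bool) : (u D.lastLeg (j.castLE (Nat.sub_le _ 1)) : ℂ) ≠
      (u D.lastLeg (lastIdx D.ell) : ℂ) * cond i ((t : ℂ) ^ (2 * (n - 1))) ((t : ℂ) ^ 2)⁻¹ := by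
    cases i with
    | true =>
      exact G.ne_mul_pow (mk_castLE_ne_lastVertex j) (j := D.lastVertex) (by omega) (by omega)
    | false =>
      intro h
      refine G.ne_mul_pow (mk_castLE_ne_lastVertex j).symm (i := D.lastVertex) (c := 2) (by omega)
        (by omega) ?_
      rw [h]
      simp only [cond_false, lastVertex]
      field_simp
  refine Function.Injective.sumElim ?_ ?_ fun i j => (h2 j i).symm
  · intro i j h
    cases i <;> cases j
    · rfl
    · exact absurd h.symm h1
    · exact absurd h h1
    · rfl
  · intro i j h
    exact Fin.castLE_injective _ (G.injective (by omega) D.lastLeg h)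

end AffineStar

/-! ### Multiplicities on `V'` and the resulting tuple of matrices -/

namespace RegularIrrep

open AffineStar

variable {D : AffineStar} {n : ℕ} {u : D.Params} {t : ℂˣ} {B : ℕ}

theorem aeval_tildeU_lastLeg (G : IsGeneric B u t) (hn : 2 ≤ n) (hB : 2 * n + 2 ≤ B)
    (V : RegularIrrep D n u t) :
    aeval (V.tildeU hn D.lastLeg) (∏ i, (X - C (lastEigenvalue n u t i))) = 0 := by
  obtain ⟨e, he⟩ := V.exists_equiv_invariants hn
  ext x
  obtain ⟨x, rfl⟩ := e.surjective x
  rw [prod_lastEigenvalue hn, he]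
  · rfl
  · exact ArikiKoike.heckeRelations.aeval_jm (G.heckeGeneric hn hB) (n - 1) le_rfl x.1 x.2

/-- The space is nonzero because `exists_inv` provides an invariant on which the trivial character
takes a nonzero value; the upper bound comes from `invariants_finite` with `N = n - 1` and `deg F =
ℓ - 1`. -/
theorem finite_primeSpace (G : IsGeneric B u t) (hn : 2 ≤ n) (hB : 2 * n + 2 ≤ B)
    (V : RegularIrrep D n u t) : FiniteDimensional ℂ V.primeSpace ∧
      0 < Module.finrank ℂ V.primeSpace ∧ Module.finrank ℂ V.primeSpace ≤ n * (D.ell + 1) := by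
  obtain ⟨e, -⟩ := V.exists_equiv_invariants hn
  have G' := G.heckeGeneric hn hB
  have H := ArikiKoike.heckeRelations (n := n) (v := u D.lastLeg) (t := t)
  obtain ⟨hfin, hle⟩ := H.invariants_finite G' (ArikiKoike.monic_cofactor _ _)
    ArikiKoike.adjoin_eq_top
  have : FiniteDimensional ℂ V.primeSpace := Module.Finite.equiv e
  refine ⟨this, ?_, ?_⟩
  · obtain ⟨x, γ, hγ, hx, -, hχ⟩ := H.exists_inv G' (n - 1) le_rfl
    have hχx := hχ (ArikiKoike.triv n D.ell (u D.lastLeg) t) ArikiKoike.triv_U fun i hi => by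
      rw [ArikiKoike.natT_of_lt hi, ArikiKoike.triv_T]
    have hx0 : x ≠ 0 := by
      rintro rfl
      exact hγ (by rw [← hχx, map_zero])
    rw [← e.finrank_eq]
    have hx' : x ∈ HeckeRelations.invariants (t : ℂ) (u D.lastLeg (lastIdx D.ell) : ℂ)
        (ArikiKoike.natT n D.ell (u D.lastLeg) t) (ArikiKoike.U n D.ell (u D.lastLeg) t)
          (n - 1) := hx
    exact (Module.finrank_pos_iff_exists_ne_zero (R := ℂ)).2
      ⟨⟨x, hx'⟩, fun h => hx0 (congrArg Subtype.val h)⟩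
  · rw [← e.finrank_eq]
    refine hle.trans (le_of_eq ?_)
    have : 2 ≤ D.ell := D.two_le_d D.lastLeg
    rw [ArikiKoike.natDegree_cofactor]
    change (n - 1 + 1) * (D.ell - 1 + 2) = n * (D.ell + 1)
    congr 1 <;> omega

/-- The multiplicities of the eigenvalues of the operators `Ũ_k` on `V'`. -/
theorem finrank_eigenspaces (hn : 2 ≤ n) (hB : 2 * n * (n * (D.ell + 1)) + 2 * n + 2 ≤ B)
    (G : IsGeneric B u t) (V : RegularIrrep D n u t) :
    Module.finrank ℂ V.primeSpace = n * D.ell ∧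
      (∀ k, k ≠ D.lastLeg → ∀ j, Module.finrank ℂ
        (Module.End.eigenspace (V.tildeU hn k) (u k j : ℂ)) = n * D.ell / D.d k) ∧
      (∀ i, Module.finrank ℂ (Module.End.eigenspace (V.tildeU hn D.lastLeg)
        (lastEigenvalue n u t (Sum.inl i))) = cond i 1 (n - 1)) ∧
      ∀ j, Module.finrank ℂ (Module.End.eigenspace (V.tildeU hn D.lastLeg)
        (lastEigenvalue n u t (Sum.inr j))) = n := by
  classical
  have hB' : 2 * n + 2 ≤ B := by omega
  obtain ⟨hfin, hpos, hle⟩ := V.finite_primeSpace G hn hB'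
  have hlast := V.aeval_tildeU_lastLeg G hn hB'
  have hinj := G.injective_lastEigenvalue hn hB'
  set E : ∀ k : Fin D.m, ℂ → ℕ := fun k c =>
    Module.finrank ℂ (Module.End.eigenspace (V.tildeU hn k) c) with hE
  have hEle : ∀ k c, E k c ≤ Module.finrank ℂ V.primeSpace := fun k c => Submodule.finrank_le _
  set a := E D.lastLeg (lastEigenvalue n u t (Sum.inl true)) with ha
  set b := E D.lastLeg (lastEigenvalue n u t (Sum.inl false)) with hb
  set dim := Module.finrank ℂ V.primeSpace with hdim
  have hsum : a + b + ∑ j, E D.lastLeg (lastEigenvalue n u t (Sum.inr j)) = dim := by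
    rw [hdim, ← sum_finrank_eigenspace _ _ hinj hlast, Fintype.sum_sum_type, Fintype.sum_bool]
  -- The eigenvalues `v t^{2(n-1)}` and `v t⁻²` of `Ũ_m` both contribute to the exponent of `v =
  -- u_{mℓ}`, hence `a + b` at the last vertex; their powers of `t` are collected in `β`.
  set α : D.Vertex → ℤ := fun i => if i = D.lastVertex then (a + b : ℤ)
    else (E i.1 (u i.1 i.2) : ℤ) with hα
  set β : ℤ := 2 * (n - 1 : ℕ) * a - 2 * b with hβ
  have hα0 : α D.lastVertex = a + b := if_pos rfl
  have hαj (j : Fin (D.ell - 1)) : α ⟨D.lastLeg, j.castLE (Nat.sub_le _ 1)⟩ =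
      E D.lastLeg (lastEigenvalue n u t (Sum.inr j)) := if_neg (mk_castLE_ne_lastVertex j)
  have hαk (k : Fin D.m) (hk : k ≠ D.lastLeg) (j) : α ⟨k, j⟩ = E k (u k j) :=
    if_neg fun h => hk (congrArg Sigma.fst h)
  have hdet : ∀ k, LinearMap.det (V.tildeU hn k) =
      (((∏ j, u k j ^ α ⟨k, j⟩) * if k = D.lastLeg then t ^ β else 1 : ℂˣ) : ℂ) := by
    intro k
    by_cases hk : k = D.lastLeg
    · subst hk
      rw [det_eq_prod_eigenvalues _ _ hinj hlast, if_pos rfl, prod_eq_lastIdx_mul,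
        Fintype.prod_sum_type, Fintype.prod_bool]
      have e0 : α ⟨D.lastLeg, lastIdx D.ell⟩ = a + b := hα0
      simp only [e0, hαj, zpow_natCast, Units.val_mul, Units.coe_prod, Units.val_pow_eq_pow_val]
      change lastEigenvalue n u t (Sum.inl true) ^ a * lastEigenvalue n u t (Sum.inl false) ^ b *
        ∏ j, (u D.lastLeg (Fin.castLE (Nat.sub_le _ 1) j) : ℂ) ^
          E D.lastLeg (lastEigenvalue n u t (Sum.inr j)) = _
      have ht := t.ne_zero
      have e1 : ((u D.lastLeg (lastIdx D.ell) ^ ((a : ℤ) + b) : ℂˣ) : ℂ) =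
          (u D.lastLeg (lastIdx D.ell) : ℂ) ^ a * (u D.lastLeg (lastIdx D.ell) : ℂ) ^ b := by
        rw [← Nat.cast_add, zpow_natCast, Units.val_pow_eq_pow_val, pow_add]
      have e2 : ((t ^ β : ℂˣ) : ℂ) = (t : ℂ) ^ (2 * (n - 1) * a) * (((t : ℂ) ^ 2)⁻¹) ^ b := by
        have : β = ((2 * (n - 1) * a : ℕ) : ℤ) - ((2 * b : ℕ) : ℤ) := by
          rw [hβ]; push_cast; ring
        rw [this, zpow_sub, zpow_natCast, zpow_natCast, Units.val_mul, Units.val_inv_eq_inv_val,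
          Units.val_pow_eq_pow_val, Units.val_pow_eq_pow_val, inv_pow, pow_mul _ 2 b]
      rw [e1, e2]
      have e3 : lastEigenvalue n u t (Sum.inl true) =
          (u D.lastLeg (lastIdx D.ell) : ℂ) * (t : ℂ) ^ (2 * (n - 1)) := rfl
      have e4 : lastEigenvalue n u t (Sum.inl false) =
          (u D.lastLeg (lastIdx D.ell) : ℂ) * ((t : ℂ) ^ 2)⁻¹ := rfl
      rw [e3, e4, mul_pow, mul_pow, ← pow_mul]
      ring
    · rw [det_eq_prod_eigenvalues _ _ (G.injective (by omega) k) (V.aeval_tildeU hn k hk), if_neg hk,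
        mul_one]
      simp only [hαk k hk, zpow_natCast, Units.coe_prod, Units.val_pow_eq_pow_val]
      rfl
  -- This is the determinant of the relation `Ũ_1 ⋯ Ũ_m = 1`.
  have hmon : monomialVal u t α β = 1 := by
    refine Units.ext ?_
    have h1 := congrArg LinearMap.det (V.prod_tildeU hn)
    rw [map_one, map_list_prod, List.map_ofFn, List.prod_ofFn] at h1
    simp only [Function.comp_apply, hdet] at h1
    rw [← Units.coe_prod, Finset.prod_mul_distrib, Finset.prod_ite_eq' Finset.univ,
      if_pos (Finset.mem_univ _)] at h1
    rw [monomialVal, Fintype.prod_sigma, h1, Units.val_one]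
  have hn1 : ((n - 1 : ℕ) : ℤ) = n - 1 := by rw [Nat.cast_sub (by omega), Nat.cast_one]
  have hab : a + b ≤ dim := by omega
  have hM : dim ≤ 2 * n * (n * (D.ell + 1)) := hle.trans (Nat.le_mul_of_pos_left _ (by omega))
  -- All multiplicities are at most `n(ℓ+1)`, so the exponents lie below the bound `B`; its factor
  -- `2n` accounts for the coefficients in `β`.
  obtain ⟨hβ0, hprop⟩ := G α β (fun i => by
      simp only [hα]
      split_ifs with hi
      · rw [abs_of_nonneg (by positivity)]
        exact_mod_cast (by omega : a + b ≤ B)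
      · rw [Nat.abs_cast]
        have := hEle i.1 (u i.1 i.2)
        exact_mod_cast (by omega : E i.1 (u i.1 i.2) ≤ B)) (by
      have h1 : (n - 1) * a ≤ n * (n * (D.ell + 1)) := Nat.mul_le_mul (by omega) (by omega)
      have h2 : b ≤ n * (n * (D.ell + 1)) :=
        (show b ≤ n * (D.ell + 1) by omega).trans (Nat.le_mul_of_pos_left _ (by omega))
      have h3 : 2 * n * (n * (D.ell + 1)) = 2 * (n * (n * (D.ell + 1))) := by ring
      have h4 : β = 2 * (((n - 1) * a : ℕ) : ℤ) - 2 * b := by rw [hβ]; push_cast; ring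
      rw [h4, abs_le]
      constructor <;> omega) hmon
  -- This is the vanishing of the total exponent of `t`.
  have hbn : b = (n - 1) * a := by
    have : (b : ℤ) = ((n - 1) * a : ℕ) := by push_cast; linarith
    exact_mod_cast this
  have hab' : a + b = n * a := by
    obtain ⟨k, rfl⟩ : ∃ k, n = k + 1 := ⟨n - 1, by omega⟩
    rw [hbn, Nat.add_sub_cancel]; ring
  rw [hα0] at hprop
  have hEj (j : Fin (D.ell - 1)) : E D.lastLeg (lastEigenvalue n u t (Sum.inr j)) = n * a := by
    have := hprop ⟨D.lastLeg, j.castLE (Nat.sub_le _ 1)⟩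
    rw [hαj, Nat.div_self (D.d_pos _), Nat.cast_one, mul_one] at this
    rw [← hab']
    exact_mod_cast this
  have hl : 2 ≤ D.ell := D.two_le_d D.lastLeg
  have hdim' : dim = a * (n * D.ell) := by
    rw [← hsum, Finset.sum_congr rfl fun j _ => hEj j, hab']
    simp only [Finset.sum_const, Finset.card_univ, Fintype.card_fin, smul_eq_mul]
    obtain ⟨l, hl'⟩ : ∃ l, D.ell = l + 1 := ⟨D.ell - 1, by omega⟩
    rw [hl', Nat.add_sub_cancel]; ring
  -- `a = 0` contradicts `V' ≠ 0`, and `a ≥ 2` would give `2nℓ ≤ n(ℓ+1)`, impossible for `ℓ ≥ 2`.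
  have ha1 : a = 1 := by
    have h0 : a ≠ 0 := by
      intro h
      rw [h, zero_mul] at hdim'
      omega
    by_contra h1
    have h2 : 2 * (n * D.ell) ≤ a * (n * D.ell) := Nat.mul_le_mul_right _ (by omega)
    have h3 : n * 2 ≤ n * D.ell := Nat.mul_le_mul_left _ hl
    rw [mul_add, mul_one] at hle
    omega
  refine ⟨by rw [hdim', ha1, one_mul], fun k hk j => ?_, ?_, fun j => ?_⟩
  · have := hprop ⟨k, j⟩
    rw [hαk k hk, ← Nat.cast_add, hab', ha1, mul_one] at this
    rw [Nat.mul_div_assoc _ (d_dvd_ell k)]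
    exact_mod_cast this
  · rintro (_ | _)
    · exact hbn.trans (by rw [ha1, mul_one]; rfl)
    · exact ha1
  · exact (hEj j).trans (by rw [ha1, mul_one])

theorem det_tildeU_ne_zero (hn : 2 ≤ n) (V : RegularIrrep D n u t) (k : Fin D.m) :
    LinearMap.det (V.tildeU hn k) ≠ 0 := by
  have h1 := congrArg LinearMap.det (V.prod_tildeU hn)
  rw [map_one, map_list_prod, List.map_ofFn, List.prod_ofFn] at h1
  intro h0
  rw [Finset.prod_eq_zero (Finset.mem_univ k) h0] at h1
  exact zero_ne_one h1

/-- The tuple of matrices of the operators `Ũ_k` in a basis of `V'`. -/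
theorem exists_dsTuple (hn : 2 ≤ n) (hB : 2 * n * (n * (D.ell + 1)) + 2 * n + 2 ≤ B)
    (G : IsGeneric B u t) (V : RegularIrrep D n u t)
    (b : Module.Basis (Fin (n * D.ell)) ℂ V.primeSpace) :
    ∃ X : DSTuple D n u t, ∀ k, (X.X k).val = LinearMap.toMatrix b b (V.tildeU hn k) := by
  have hB' : 2 * n + 2 ≤ B := by omega
  obtain ⟨-, h2, h3, h4⟩ := V.finrank_eigenspaces hn hB G
  have : FiniteDimensional ℂ V.primeSpace := Module.Basis.finiteDimensional_of_finite b
  refine ⟨⟨fun k => Matrix.GeneralLinearGroup.mkOfDetNeZero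
    (LinearMap.toMatrix b b (V.tildeU hn k)) (by
      rw [LinearMap.det_toMatrix]; exact V.det_tildeU_ne_zero hn k), ?_, fun k hk => ?_, ?_⟩,
    fun k => rfl⟩
  · refine Units.ext ?_
    have h := congrArg (LinearMap.toMatrixAlgEquiv b) (V.prod_tildeU hn)
    rw [map_one, map_list_prod, List.map_ofFn] at h
    rw [Units.val_one, ← h, ← Units.coeHom_apply, map_list_prod, List.map_ofFn]
    rfl
  · exact similarMatrices_diagTensorId _ b _ (G.injective (by omega) k) (V.aeval_tildeU hn k hk) _
      (h2 k hk)
  · exact similarMatrices_fromBlocks _ (by omega) b t _ _ _ rfl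
      (G.injective_lastEigenvalue hn hB') (V.aeval_tildeU_lastLeg G hn hB') h3 h4

/-- Isomorphic representations give conjugate tuples. -/
theorem dsTuple_equiv (hn : 2 ≤ n) {V W : RegularIrrep D n u t}
    (e : V.carrier ≃ₗ[GDAHA D n u t] W.carrier)
    (b : Module.Basis (Fin (n * D.ell)) ℂ V.primeSpace)
    (c : Module.Basis (Fin (n * D.ell)) ℂ W.primeSpace) {X Y : DSTuple D n u t}
    (hX : ∀ k, (X.X k).val = LinearMap.toMatrix b b (V.tildeU hn k))
    (hY : ∀ k, (Y.X k).val = LinearMap.toMatrix c c (W.tildeU hn k)) : X ≈ Y := by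
  have hmem (x : V.carrier) : x ∈ V.primeSpace ↔ e x ∈ W.primeSpace := by
    refine forall₂_congr fun h _ => ?_
    rw [← map_smul, ← e.injective.eq_iff]
    refine Eq.congr rfl ?_
    rw [← algebraMap_smul (GDAHA D n u t) (ArikiKoike.triv n D.ell (u D.lastLeg) t h) x,
      map_smul, algebraMap_smul]
  -- Linearity over `ℂ` follows because complex scalars act through the algebra.
  let e' : V.carrier ≃ₗ[ℂ] W.carrier :=
    { e with
      map_smul' := fun c x => by
        change e (c • x) = c • e x
        rw [← algebraMap_smul (GDAHA D n u t) c x, map_smul, algebraMap_smul] }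
  have hmap : V.primeSpace.map e'.toLinearMap = W.primeSpace := by
    ext y
    obtain ⟨x, rfl⟩ := e'.surjective y
    exact (Submodule.mem_map_equiv _).trans (by rw [LinearEquiv.symm_apply_apply]; exact hmem x)
  let f : V.primeSpace ≃ₗ[ℂ] W.primeSpace :=
    (e'.submoduleMap _).trans (LinearEquiv.ofEq _ _ hmap)
  have hf (k) (x : V.primeSpace) : f (V.tildeU hn k x) = W.tildeU hn k (f x) :=
    Subtype.ext (map_smul e (GDAHA.tildeU D n u t k) (x : V.carrier))
  refine ⟨⟨LinearMap.toMatrix b c f, LinearMap.toMatrix c b f.symm, ?_, ?_⟩, fun k => ?_⟩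
  · rw [← LinearMap.toMatrix_comp c b c]; simp
  · rw [← LinearMap.toMatrix_comp b c b]; simp
  · refine Units.ext ?_
    change (Y.X k).val = LinearMap.toMatrix b c f * (X.X k).val * LinearMap.toMatrix c b f.symm
    rw [hX, hY, ← LinearMap.toMatrix_comp b b c, ← LinearMap.toMatrix_comp c b c]
    congr 1
    ext x
    simp [hf]

end RegularIrrep

end

theorem mainTheorem10 (D : AffineStar) (n : ℕ) (hn : 2 ≤ n) :
    D.ForGenericParams fun u t =>
      (∀ V : RegularIrrep D n u t, Module.finrank ℂ V.primeSpace = n * D.ell) ∧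
      ∃! Φ : IrrepClasses D n u t → DSVariety D n u t,
        ∀ (V : RegularIrrep D n u t) (b : Module.Basis (Fin (n * D.ell)) ℂ V.primeSpace),
          ∃ X : DSTuple D n u t,
            (∀ k, (X.X k).val = LinearMap.toMatrix b b (V.tildeU hn k)) ∧
            Φ (Quotient.mk _ V) = Quotient.mk _ X := by
  obtain ⟨P, hP, h⟩ := AffineStar.forGenericParams_isGeneric (D := D)
    (2 * n * (n * (D.ell + 1)) + 2 * n + 2)
  refine ⟨P, hP, fun u t hq hPt => ?_⟩
  have G := h u t hq hPt
  have hdim (V : RegularIrrep D n u t) := (V.finrank_eigenspaces hn le_rfl G).1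
  have hbasis (V : RegularIrrep D n u t) :
      Nonempty (Module.Basis (Fin (n * D.ell)) ℂ V.primeSpace) := by
    have := (V.finite_primeSpace G hn (by omega)).1
    exact ⟨Module.finBasisOfFinrankEq ℂ _ (hdim V)⟩
  -- An arbitrary basis is fixed for each representation; `dsTuple_equiv` shows that the class does
  -- not depend on this choice.
  let b₀ (V : RegularIrrep D n u t) := (hbasis V).some
  choose X hX using fun V : RegularIrrep D n u t => V.exists_dsTuple hn le_rfl G (b₀ V)
  refine ⟨hdim, Quotient.lift (fun V => Quotient.mk _ (X V)) ?_, ?_, ?_⟩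
  · rintro V W ⟨e⟩
    exact Quotient.sound (RegularIrrep.dsTuple_equiv hn e (b₀ V) (b₀ W) (hX V) (hX W))
  · intro V b
    obtain ⟨Y, hY⟩ := V.exists_dsTuple hn le_rfl G b
    exact ⟨Y, hY, Quotient.sound
      (RegularIrrep.dsTuple_equiv hn (LinearEquiv.refl _ _) (b₀ V) b (hX V) hY)⟩
  -- The required property in the single basis `b₀ V` already determines the value at the class of
  -- `V`.
  · intro Ψ hΨ
    funext q
    induction q using Quotient.inductionOn with
    | h V =>
      obtain ⟨Y, hY, hΨY⟩ := hΨ V (b₀ V)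
      rw [hΨY]
      exact Quotient.sound
        (RegularIrrep.dsTuple_equiv hn (LinearEquiv.refl _ _) (b₀ V) (b₀ V) hY (hX V))
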